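/- All manifolds are smooth, finite-dimensional, Hausdorff, second countable and connected; all forms are smooth. Let $N$ be an $n$-dimensional manifold. For an $l$-vector $Z\in\Lambda^l T_xN$ and a $k$-form $\omega$ on $N$ let $\iota_Z\omega_x$ denote the contraction, which is linear in $Z$ and satisfies $\iota_{u_1\wedge\dots\wedge u_l}\omega_x=\omega_x(u_1,\dots,u_l,\cdot)$ if $l\le k$ (and $\iota_Z\omega_x=0$ if $l>k$). The form $\omega$ is called $j$-nondegenerate if for every $x\in N$ the map $Z\mapsto\iota_Z\omega_x$ is injective on $\Lambda^jT_xN$, and multisymplectic if it is closed and $1$-nondegenerate. If $\Theta$ is a multisymplectic $k$-form and $l+1\le k$, an $l$-multivector field $Y$ is Hamiltonian with respect to $\Theta$ if $\iota_Y\Theta=d\theta$ for some $(k-l-1)$-form $\theta$ on $N$. **Theorem.** Let $r\ge 0$ and $k\ge r+1$ be integers, let $\Theta$ be an $(r+1)$-nondegenerate multisymplectic $k$-form on $N$, and let $G$ be a connected $r$-dimensional Lie group that is unimodular, i.e. its left-invariant volume form is also right-invariant. Let $G$ act on $N$ smoothly, properly and freely, and let $V_\Phi$ be the space of fundamental vector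 fields $\xi_N(x)=T_e(g\mapsto g\cdot x)\,\xi$, $\xi\in T_eG$, of the action. Let $w\in\Lambda^rV_\Phi\setminus\{0\}$ be such that the $r$-multivector field on $N$ defined by $w$ is Hamiltonian with respect to $\Theta$. Then the orbit space $N/G$ is Hausdorff and second countable, and it carries a structure of smooth manifold of dimension $n-r\ge 0$ for which the quotient projection $\pi\colon N\to N/G$ is a smooth submersion; and for every such structure there exists a unique multisymplectic form $\widetilde\Theta$ on $N/G$, of degree $k-r$, with $$\pi^*\widetilde\Theta=\iota_w\Theta .$$ -/

import Mathlib

open scoped Manifold ContDiff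

noncomputable section

namespace Multisymplectic

/-! ### Multivectors and their contraction with alternating forms -/

section Algebra

variable {l s k : ℕ}

theorem append_update_right {V : Type*} (u : Fin l → V) (v : Fin s → V) (i : Fin s) (x : V) :
    Fin.append u (Function.update v i x) =
      Function.update (Fin.append u v) (Fin.natAdd l i) x := by
  funext j
  refine Fin.addCases (fun a => ?_) (fun a => ?_) j
  · have h : Fin.castAdd s a ≠ Fin.natAdd l i := by
      intro h
      have h2 := congrArg Fin.val h
      simp only [Fin.val_castAdd, Fin.val_natAdd] at h2
      omega
    simp [Function.update_of_ne h]
  · by_cases h : a = i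
    · subst h
      simp
    · have h' : Fin.natAdd l a ≠ Fin.natAdd l i := by
        intro hh
        exact h (by simpa using hh)
      simp [Function.update_of_ne h, Function.update_of_ne h']

theorem append_update_left {V : Type*} (u : Fin l → V) (v : Fin s → V) (i : Fin l) (x : V) :
    Fin.append (Function.update u i x) v =
      Function.update (Fin.append u v) (Fin.castAdd s i) x := by
  funext j
  refine Fin.addCases (fun a => ?_) (fun a => ?_) j
  · by_cases h : a = i
    · subst h
      simp
    · have h' : Fin.castAdd s a ≠ Fin.castAdd s i := by
        intro hh
        exact h (by simpa using hh)
      simp [Function.update_of_ne h, Function.update_of_ne h']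
  · have h : Fin.natAdd l a ≠ Fin.castAdd s i := by
      intro h
      have h2 := congrArg Fin.val h
      simp only [Fin.val_castAdd, Fin.val_natAdd] at h2
      omega
    simp [Function.update_of_ne h]

variable {V : Type*} [AddCommGroup V] [Module ℝ V] [TopologicalSpace V]

/-- The form `v ↦ α (u₁, …, u_l, v₁, …, v_s)`, of degree `s = k - l`. -/
def contractTuple (h : l + s = k) (α : V [⋀^Fin k]→L[ℝ] ℝ) (u : Fin l → V) :
    V [⋀^Fin s]→L[ℝ] ℝ where
  toFun v := α (Fin.append u v ∘ Fin.cast h.symm)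
  map_update_add' := by
    intro inst v i x y
    obtain rfl : inst = instDecidableEqFin s := Subsingleton.elim _ _
    subst h
    simp [append_update_right]
  map_update_smul' := by
    intro inst v i c x
    obtain rfl : inst = instDecidableEqFin s := Subsingleton.elim _ _
    subst h
    simp [append_update_right]
  map_eq_zero_of_eq' := by
    intro v i j hij hne
    subst h
    refine α.map_eq_zero_of_eq (i := Fin.natAdd l i) (j := Fin.natAdd l j) _ ?_ ?_
    · simpa using hij
    · intro hh
      exact hne (by simpa using hh)
  cont := by
    subst h
    refine α.cont.comp (continuous_pi fun j => ?_)
    refine Fin.addCases (fun a => ?_) (fun a => ?_) j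
    · simpa using continuous_const
    · simpa using continuous_apply a

@[simp] theorem contractTuple_apply (h : l + s = k) (α : V [⋀^Fin k]→L[ℝ] ℝ) (u : Fin l → V)
    (v : Fin s → V) : contractTuple h α u v = α (Fin.append u v ∘ Fin.cast h.symm) := rfl

/-- `contractTuple` as an alternating map of `u`. -/
def contractAlternating (h : l + s = k) (α : V [⋀^Fin k]→L[ℝ] ℝ) :
    V [⋀^Fin l]→ₗ[ℝ] (V [⋀^Fin s]→L[ℝ] ℝ) where
  toFun u := contractTuple h α u
  map_update_add' := by
    intro inst u i x y
    obtain rfl : inst = instDecidableEqFin l := Subsingleton.elim _ _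
    subst h
    ext v
    simp [append_update_left]
  map_update_smul' := by
    intro inst u i c x
    obtain rfl : inst = instDecidableEqFin l := Subsingleton.elim _ _
    subst h
    ext v
    simp [append_update_left]
  map_eq_zero_of_eq' := by
    intro u i j hij hne
    subst h
    ext v
    refine α.map_eq_zero_of_eq (i := Fin.castAdd s i) (j := Fin.castAdd s j) _ ?_ ?_
    · simpa using hij
    · intro hh
      exact hne (by simpa using hh)

/-- The contraction `ι_Z α` of a `k`-form `α` with an `l`-vector `Z ∈ Λ^l V`. It is linear in `Z`,
and `ι_{u₁ ∧ … ∧ u_l} α = α (u₁, …, u_l, ·)`; see `contract_ιMulti`. -/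
def contract (h : l + s = k) (α : V [⋀^Fin k]→L[ℝ] ℝ) (Z : ⋀[ℝ]^l V) : V [⋀^Fin s]→L[ℝ] ℝ :=
  exteriorPower.alternatingMapLinearEquiv (contractAlternating h α) Z

theorem contract_ιMulti (h : l + s = k) (α : V [⋀^Fin k]→L[ℝ] ℝ) (u : Fin l → V)
    (v : Fin s → V) :
    contract h α (exteriorPower.ιMulti ℝ l u) v = α (Fin.append u v ∘ Fin.cast h.symm) := by
  simp [contract, contractAlternating]

end Algebra

/-! ### Differential forms on manifolds -/

section Forms

variable {E : Type*} [NormedAddCommGroup E] [NormedSpace ℝ E]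
  {M : Type*} [TopologicalSpace M] [ChartedSpace E M]
  {E' : Type*} [NormedAddCommGroup E'] [NormedSpace ℝ E']
  {M' : Type*} [TopologicalSpace M'] [ChartedSpace E' M']

/-- A (not necessarily smooth) field of alternating `k`-forms on the tangent spaces of `M`. -/
abbrev FormField (E : Type*) [NormedAddCommGroup E] [NormedSpace ℝ E]
    (M : Type*) [TopologicalSpace M] [ChartedSpace E M] (k : ℕ) : Type _ :=
  ∀ x : M, TangentSpace 𝓘(ℝ, E) x [⋀^Fin k]→L[ℝ] ℝ

/-- A (not necessarily smooth) field of `l`-vectors on `M`. -/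
abbrev MultivectorField (E : Type*) [NormedAddCommGroup E] [NormedSpace ℝ E]
    (M : Type*) [TopologicalSpace M] [ChartedSpace E M] (l : ℕ) : Type _ :=
  ∀ x : M, ⋀[ℝ]^l (TangentSpace 𝓘(ℝ, E) x)

/-- The pullback `f^* α`. -/
def pullback {k : ℕ} (f : M → M') (α : FormField E' M' k) : FormField E M k :=
  fun x => (α (f x)).compContinuousLinearMap (mfderiv 𝓘(ℝ, E) 𝓘(ℝ, E') f x)

/-- The expression `(φ⁻¹)^* α` of `α` in the preferred chart `φ` at `x`; it is meaningful on the
(open) target of that chart. Here `T_yE` is identified with `E`. -/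
def localForm {k : ℕ} (α : FormField E M k) (x : M) : E → E [⋀^Fin k]→L[ℝ] ℝ :=
  fun y => (α ((extChartAt 𝓘(ℝ, E) x).symm y)).compContinuousLinearMap
    ((mfderiv 𝓘(ℝ, E) 𝓘(ℝ, E) (extChartAt 𝓘(ℝ, E) x).symm y).comp
      (NormedSpace.fromTangentSpace y).symm.toContinuousLinearMap)

/-- `α` is a smooth differential form: its local expressions are smooth. -/
def IsSmooth {k : ℕ} (α : FormField E M k) : Prop :=
  ∀ x : M, ContDiffOn ℝ ∞ (localForm α x) (extChartAt 𝓘(ℝ, E) x).target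

/-- The exterior derivative `dα`, computed at `x` in the preferred chart `φ` at `x`:
`(dα)_x = φ^* (d ((φ⁻¹)^* α))_{φ(x)}`. -/
def extD {k : ℕ} (α : FormField E M k) : FormField E M (k + 1) :=
  fun x => (extDeriv (localForm α x) (extChartAt 𝓘(ℝ, E) x x)).compContinuousLinearMap
    ((NormedSpace.fromTangentSpace (extChartAt 𝓘(ℝ, E) x x)).toContinuousLinearMap.comp
      (mfderiv 𝓘(ℝ, E) 𝓘(ℝ, E) (extChartAt 𝓘(ℝ, E) x) x))

/-- The contraction `ι_Y α` of a `k`-form with an `l`-multivector field. -/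
def contractField {l s k : ℕ} (h : l + s = k) (α : FormField E M k)
    (Y : MultivectorField E M l) : FormField E M s :=
  fun x => contract h (α x) (Y x)

/-- A `k`-form `α` is `j`-nondegenerate if at each point `x` the map `Z ↦ ι_Z α_x` is injective on
`Λ^j T_xM`. (If `j > k` then `ι_Z α_x` is zero for every `Z`, so that the condition below
reduces to `Λ^j T_xM = 0`.) -/
def IsNondegenerate {k : ℕ} (j : ℕ) (α : FormField E M k) : Prop :=
  ∀ (x : M) (Z : ⋀[ℝ]^j (TangentSpace 𝓘(ℝ, E) x)),
    (∀ (s : ℕ) (h : j + s = k), contract h (α x) Z = 0) → Z = 0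

/-- A multisymplectic form is a closed, one-nondegenerate (smooth) differential form. -/
structure IsMultisymplectic {k : ℕ} (α : FormField E M k) : Prop where
  smooth : IsSmooth α
  closed : extD α = 0
  nondegenerate : IsNondegenerate 1 α

/-- An `l`-multivector field `Y` is Hamiltonian with respect to a form `Θ` of degree
`k = l + (m + 1)` if `ι_Y Θ = dθ` for a differential form `θ` of degree `m = k - l - 1`. -/
def IsHamiltonian {l m k : ℕ} (h : l + (m + 1) = k) (Θ : FormField E M k)
    (Y : MultivectorField E M l) : Prop :=
  ∃ θ : FormField E M m, IsSmooth θ ∧ contractField h Θ Y = extD θ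

end Forms

/-! ### Lie groups and their actions -/

section Actions

variable {F : Type*} [NormedAddCommGroup F] [NormedSpace ℝ F]
  {E : Type*} [NormedAddCommGroup E] [NormedSpace ℝ E]

/-- An `r`-dimensional Lie group `G` is unimodular if its Haar volume form (the left-invariant
volume form, which is unique up to a nonzero factor) is also right-invariant. -/
def IsUnimodular (r : ℕ) (G : Type*) [Group G] [TopologicalSpace G]
    [ChartedSpace (EuclideanSpace ℝ (Fin r)) G] : Prop :=
  ∃ η : FormField (EuclideanSpace ℝ (Fin r)) G r,
    IsSmooth η ∧ (∀ x : G, η x ≠ 0) ∧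
    (∀ g : G, pullback (fun x => g * x) η = η) ∧
    (∀ g : G, pullback (fun x => x * g) η = η)

variable (F E) (G : Type*) [Group G] [TopologicalSpace G] [ChartedSpace F G]
  (N : Type*) [TopologicalSpace N] [ChartedSpace E N] [MulAction G N]

/-- The map `ξ ↦ ξ_N` sending `ξ ∈ T_e G` to its fundamental vector field
`ξ_N(x) = T_e(g ↦ g • x) ξ`. (The right-hand side is a vector at `1 • x = x`; as a type every
tangent space of `N` is the model space `E`, so no transport is needed.) -/
def fundamentalField :
    GroupLieAlgebra 𝓘(ℝ, F) G →ₗ[ℝ] (∀ x : N, TangentSpace 𝓘(ℝ, E) x) :=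
  LinearMap.pi fun x =>
    (mfderiv 𝓘(ℝ, F) 𝓘(ℝ, E) (fun g : G => g • x) 1).toLinearMap

/-- The space `V_Φ` of fundamental vector fields of the action. -/
def fundamentalFields : Submodule ℝ (∀ x : N, TangentSpace 𝓘(ℝ, E) x) :=
  LinearMap.range (fundamentalField F E G N)

variable {F E G N}

/-- The `l`-multivector field on `N` given by an element `w` of `Λ^l V_Φ`: its value at `x` is
the image of `w` under evaluation of vector fields at `x`. -/
def toMultivectorField {l : ℕ} (w : ⋀[ℝ]^l (fundamentalFields F E G N)) :
    MultivectorField E N l :=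
  fun x => exteriorPower.map l
    ((LinearMap.proj x : (∀ y : N, TangentSpace 𝓘(ℝ, E) y) →ₗ[ℝ] TangentSpace 𝓘(ℝ, E) x) ∘ₗ
      (fundamentalFields F E G N).subtype) w

variable (G N) in
/-- The quotient projection `π : N → N/G`. -/
def proj : N → MulAction.orbitRel.Quotient G N := Quotient.mk _

/-- A charted space structure on the orbit space `N/G` (with the quotient topology) is a quotient
manifold structure if it is a smooth manifold structure for which `π : N → N/G` is a smooth
submersion. (There is at most one such smooth structure.) -/
structure IsQuotientManifold (E : Type*) [NormedAddCommGroup E] [NormedSpace ℝ E]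
    (B : Type*) [NormedAddCommGroup B] [NormedSpace ℝ B]
    (G : Type*) [Group G] (N : Type*) [TopologicalSpace N] [ChartedSpace E N] [MulAction G N]
    [ChartedSpace B (MulAction.orbitRel.Quotient G N)] : Prop where
  isManifold : IsManifold 𝓘(ℝ, B) ∞ (MulAction.orbitRel.Quotient G N)
  contMDiff_proj : ContMDiff 𝓘(ℝ, E) 𝓘(ℝ, B) ∞ (proj G N)
  surjective_mfderiv_proj :
    ∀ x : N, Function.Surjective (mfderiv 𝓘(ℝ, E) 𝓘(ℝ, B) (proj G N) x)

end Actions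

end Multisymplectic

end

noncomputable section

namespace Multisymplectic

open Set Filter Topology

/-! Write α = ι_w Θ. Freeness makes ξ ↦ ξ_N(x) injective, so V_Φ has dimension r, its top exterior
power is a line, and w is a nonzero multiple of e₁ ∧ … ∧ e_r for a basis e of V_Φ. Three properties
of α follow. It is smooth and closed, because the Hamiltonian condition makes it exact. It is
horizontal: inserting a further vertical vector gives Θ linearly dependent arguments. Being closed
and horizontal, it has vanishing Lie derivative along fundamental fields (Cartan's formula), so it
is invariant under the connected group G (`pull_translate_eq`).

A horizontal invariant form descends along π (`exists_pullback_proj_eq`), uniquely, since π is a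
surjective submersion (`pullback_injective`). Pulling back along local sections of π transfers
smoothness and closedness to the descended form. Nondegeneracy (`isNondegenerate_of_pullback_eq`):
if dπ(y) annihilates it, then ι_{e₁ ∧ … ∧ e_r ∧ y} Θ = 0, hence e₁ ∧ … ∧ e_r ∧ y = 0 by
(r+1)-nondegeneracy, so y is vertical and dπ(y) = 0.

The quotient manifold comes from slices: a transversal to an orbit is swept out by the group through
the inverse function theorem, and properness makes a small transversal meet each orbit at most once
(`exists_slice`). -/

/-! ### Smooth dependence of pullbacks of alternating maps -/

section AlternatingSmooth

variable {E E' X : Type*} [NormedAddCommGroup E] [NormedSpace ℝ E]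
  [NormedAddCommGroup E'] [NormedSpace ℝ E'] [NormedAddCommGroup X] [NormedSpace ℝ X] {k : ℕ}

/-- The normalized alternatization, a continuous left inverse of the inclusion of alternating maps
into multilinear maps. -/
def alternatize (E : Type*) [NormedAddCommGroup E] [NormedSpace ℝ E] (k : ℕ) :
    ContinuousMultilinearMap ℝ (fun _ : Fin k => E) ℝ →L[ℝ] E [⋀^Fin k]→L[ℝ] ℝ :=
  LinearMap.mkContinuous
    { toFun := fun f => ((k.factorial : ℝ)⁻¹) • ContinuousMultilinearMap.alternatization f
      map_add' := fun f g => by rw [map_add, smul_add]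
      map_smul' := fun c f => by
        ext v
        simp [ContinuousMultilinearMap.alternatization_apply_apply, Finset.mul_sum,
          mul_left_comm, mul_smul_comm] }
    1 (fun f => by
      refine ContinuousAlternatingMap.opNorm_le_bound _ (by positivity) fun v => ?_
      have hb : ∀ σ ∈ (Finset.univ : Finset (Equiv.Perm (Fin k))),
          ‖Equiv.Perm.sign σ • f (v ∘ σ)‖ ≤ ‖f‖ * ∏ i, ‖v i‖ := fun σ _ => by
        have h1 : ‖Equiv.Perm.sign σ • f (v ∘ σ)‖ = ‖f (v ∘ σ)‖ := by
          rcases Int.units_eq_one_or (Equiv.Perm.sign σ) with h | h <;> simp [h]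
        rw [h1]
        refine (f.le_opNorm _).trans_eq ?_
        congr 1
        exact Equiv.prod_comp σ fun i => ‖v i‖
      have h2 := norm_sum_le_of_le _ hb
      rw [Finset.sum_const, Finset.card_univ, Fintype.card_perm, Fintype.card_fin,
        nsmul_eq_mul] at h2
      have h3 : (0 : ℝ) < k.factorial := by exact_mod_cast k.factorial_pos
      simp only [LinearMap.coe_mk, AddHom.coe_mk, ContinuousAlternatingMap.smul_apply,
        ContinuousMultilinearMap.alternatization_apply_apply, norm_smul, norm_inv, one_mul,
        Real.norm_natCast]
      rw [inv_mul_le_iff₀ h3]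
      exact h2)

theorem alternatize_apply (f : E [⋀^Fin k]→L[ℝ] ℝ) :
    alternatize E k f.toContinuousMultilinearMap = f := by
  ext v
  have h3 : (k.factorial : ℝ) ≠ 0 := by exact_mod_cast k.factorial_ne_zero
  have h : ∀ σ ∈ (Finset.univ : Finset (Equiv.Perm (Fin k))),
      Equiv.Perm.sign σ • f.toContinuousMultilinearMap (v ∘ σ) = f v := fun σ _ => by
    have := f.toAlternatingMap.map_perm v σ
    rcases Int.units_eq_one_or (Equiv.Perm.sign σ) with h | h <;> simp_all
  change (k.factorial : ℝ)⁻¹ •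
    (ContinuousMultilinearMap.alternatization f.toContinuousMultilinearMap) v = f v
  rw [ContinuousMultilinearMap.alternatization_apply_apply, Finset.sum_congr rfl h,
    Finset.sum_const, Finset.card_univ, Fintype.card_perm, Fintype.card_fin, nsmul_eq_mul,
    smul_eq_mul, inv_mul_cancel_left₀ h3]

/-- On multilinear maps, substitution is linear in the form and continuous multilinear in the inner
maps, hence smooth. `alternatize` carries this back to alternating maps. -/
theorem contDiffAt_compContinuousLinearMap {n : ℕ∞ω} {f : X → E' [⋀^Fin k]→L[ℝ] ℝ}
    {g : X → E →L[ℝ] E'} {x : X} (hf : ContDiffAt ℝ n f x) (hg : ContDiffAt ℝ n g x) :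
    ContDiffAt ℝ n (fun y => (f y).compContinuousLinearMap (g y)) x := by
  have h : (fun y => (f y).compContinuousLinearMap (g y)) = fun y => alternatize E k
      (ContinuousMultilinearMap.compContinuousLinearMapContinuousMultilinear ℝ
        (fun _ : Fin k => E) (fun _ : Fin k => E') ℝ (fun _ => g y)
        (ContinuousAlternatingMap.toContinuousMultilinearMapCLM ℝ (f y))) := by
    funext y
    rw [← alternatize_apply ((f y).compContinuousLinearMap (g y))]
    rfl
  rw [h]
  refine (alternatize E k).contDiff.contDiffAt.comp x (ContDiffAt.clm_apply ?_ ?_)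
  · exact (ContinuousMultilinearMap.contDiff _).contDiffAt.comp x
      (contDiffAt_pi.2 fun _ => hg)
  · exact (ContinuousLinearMap.contDiff _).contDiffAt.comp x hf

theorem two_le_infty : minSmoothness ℝ 2 ≤ ∞ := by
  rw [minSmoothness_of_isRCLikeNormedField]
  exact ENat.LEInfty.out

theorem contDiffAt_extDeriv {β : E → E [⋀^Fin k]→L[ℝ] ℝ} {x : E} (h : ContDiffAt ℝ ∞ β x) :
    ContDiffAt ℝ ∞ (extDeriv β) x :=
  ContDiffAt.comp (g := ContinuousAlternatingMap.alternatizeUncurryFinCLM ℝ E ℝ) x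
    (ContinuousLinearMap.contDiff _).contDiffAt (h.fderiv_right (m := ∞) (by simp))

end AlternatingSmooth

/-! ### Derivatives and pullbacks with values in the model spaces -/

section Pull

variable {E : Type*} [NormedAddCommGroup E] [NormedSpace ℝ E]
  {M : Type*} [TopologicalSpace M] [ChartedSpace E M]
  {E' : Type*} [NormedAddCommGroup E'] [NormedSpace ℝ E']
  {M' : Type*} [TopologicalSpace M'] [ChartedSpace E' M']
  {E'' : Type*} [NormedAddCommGroup E''] [NormedSpace ℝ E'']
  {M'' : Type*} [TopologicalSpace M''] [ChartedSpace E'' M''] {k : ℕ}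

variable (E E') in
/-- The derivative of a map between manifolds, as a map between the model spaces. -/
def tderiv (f : M → M') (x : M) : E →L[ℝ] E' :=
  mfderiv 𝓘(ℝ, E) 𝓘(ℝ, E') f x

theorem tderiv_comp {g : M' → M''} {f : M → M'} (x : M)
    (hg : MDifferentiableAt 𝓘(ℝ, E') 𝓘(ℝ, E'') g (f x))
    (hf : MDifferentiableAt 𝓘(ℝ, E) 𝓘(ℝ, E') f x) :
    tderiv E E'' (g ∘ f) x = (tderiv E' E'' g (f x)).comp (tderiv E E' f x) :=
  mfderiv_comp x hg hf

theorem tderiv_congr {f f' : M → M'} {x : M} (h : f =ᶠ[𝓝 x] f') :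
    tderiv E E' f x = tderiv E E' f' x :=
  Filter.EventuallyEq.mfderiv_eq h

theorem tderiv_eq_fderiv (f : E → E') (x : E) : tderiv E E' f x = fderiv ℝ f x :=
  mfderiv_eq_fderiv

theorem tderiv_id (x : M) : tderiv E E (id : M → M) x = ContinuousLinearMap.id ℝ E :=
  mfderiv_id

theorem tderiv_const (x : M) (c : M') : tderiv E E' (fun _ : M => c) x = 0 :=
  mfderiv_const

/-- The pullback of a field of alternating forms, with tangent spaces replaced by the model
spaces. -/
def pull (f : M → M') (α : M' → E' [⋀^Fin k]→L[ℝ] ℝ) : M → E [⋀^Fin k]→L[ℝ] ℝ :=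
  fun x => (α (f x)).compContinuousLinearMap (tderiv E E' f x)

theorem pull_apply (f : M → M') (α : M' → E' [⋀^Fin k]→L[ℝ] ℝ) (x : M) (v : Fin k → E) :
    pull f α x v = α (f x) (fun i => tderiv E E' f x (v i)) := rfl

theorem localForm_eq_pull (α : FormField E M k) (x : M) :
    localForm α x = pull (extChartAt 𝓘(ℝ, E) x).symm α := rfl

theorem extD_eq (α : FormField E M k) (x : M) :
    extD α x = (extDeriv (localForm α x) (extChartAt 𝓘(ℝ, E) x x)).compContinuousLinearMap
      (tderiv E E (extChartAt 𝓘(ℝ, E) x) x) := rfl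

theorem pull_pull {g : M' → M''} {f : M → M'} (α : M'' → E'' [⋀^Fin k]→L[ℝ] ℝ) (x : M)
    (hg : MDifferentiableAt 𝓘(ℝ, E') 𝓘(ℝ, E'') g (f x))
    (hf : MDifferentiableAt 𝓘(ℝ, E) 𝓘(ℝ, E') f x) :
    (pull f (pull g α : M' → E' [⋀^Fin k]→L[ℝ] ℝ) : M → E [⋀^Fin k]→L[ℝ] ℝ) x =
      pull (g ∘ f) α x := by
  ext v
  simp only [pull_apply, tderiv_comp x hg hf, Function.comp_apply,
    ContinuousLinearMap.comp_apply]

theorem pull_congr {f f' : M → M'} (α : M' → E' [⋀^Fin k]→L[ℝ] ℝ) {x : M}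
    (h : f =ᶠ[𝓝 x] f') :
    (pull f α : M → E [⋀^Fin k]→L[ℝ] ℝ) =ᶠ[𝓝 x] pull f' α := by
  filter_upwards [eventually_eventually_nhds.2 h] with y hy
  ext v
  rw [pull_apply, pull_apply, tderiv_congr hy, hy.self_of_nhds]

variable [IsManifold 𝓘(ℝ, E) ∞ M] [IsManifold 𝓘(ℝ, E') ∞ M']

theorem eventually_mdifferentiableAt {f : M → M'} {x : M}
    (hf : ContMDiffAt 𝓘(ℝ, E) 𝓘(ℝ, E') ∞ f x) :
    ∀ᶠ z in 𝓝 x, MDifferentiableAt 𝓘(ℝ, E) 𝓘(ℝ, E') f z :=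
  ((contMDiffAt_iff_contMDiffAt_nhds (n := 1) (by simp)).1 (hf.of_le (by simp))).mono
    fun _ hz => hz.mdifferentiableAt one_ne_zero

theorem contMDiffAt_extChartAt_symm_of_mem {x : M} {y : E}
    (hy : y ∈ (extChartAt 𝓘(ℝ, E) x).target) :
    ContMDiffAt 𝓘(ℝ, E) 𝓘(ℝ, E) ∞ (extChartAt 𝓘(ℝ, E) x).symm y :=
  (contMDiffOn_extChartAt_symm x).contMDiffAt ((isOpen_extChartAt_target x).mem_nhds hy)

/-- Inserting the chart at `x` and its inverse factors the pullback through the local form, so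
results on forms in normed spaces apply to forms on manifolds. -/
theorem eventually_pull_eq {α : FormField E' M' k} {g : E → M'} {y : E} (x : M')
    (hg : ContMDiffAt 𝓘(ℝ, E) 𝓘(ℝ, E') ∞ g y) (hx : g y ∈ (extChartAt 𝓘(ℝ, E') x).source) :
    (pull g α : E → E [⋀^Fin k]→L[ℝ] ℝ) =ᶠ[𝓝 y] fun z =>
      (localForm α x (extChartAt 𝓘(ℝ, E') x (g z))).compContinuousLinearMap
        (fderiv ℝ (fun z => extChartAt 𝓘(ℝ, E') x (g z)) z) := by
  have h1 : ∀ᶠ z in 𝓝 y, g z ∈ (extChartAt 𝓘(ℝ, E') x).source :=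
    hg.continuousAt.eventually ((isOpen_extChartAt_source x).mem_nhds hx)
  have h2 : ∀ᶠ z in 𝓝 y, MDifferentiableAt 𝓘(ℝ, E) 𝓘(ℝ, E') g z :=
    eventually_mdifferentiableAt hg
  have h3 : (fun z => (extChartAt 𝓘(ℝ, E') x).symm (extChartAt 𝓘(ℝ, E') x (g z))) =ᶠ[𝓝 y] g :=
    h1.mono fun z hz => (extChartAt 𝓘(ℝ, E') x).left_inv hz
  filter_upwards [h1, h2, pull_congr (E := E) α h3] with z hz hz' hz''
  have h4 : MDifferentiableAt 𝓘(ℝ, E') 𝓘(ℝ, E') (extChartAt 𝓘(ℝ, E') x) (g z) :=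
    mdifferentiableAt_extChartAt (by rwa [extChartAt_source] at hz)
  have h5 : MDifferentiableAt 𝓘(ℝ, E') 𝓘(ℝ, E') (extChartAt 𝓘(ℝ, E') x).symm
      (extChartAt 𝓘(ℝ, E') x (g z)) :=
    (contMDiffAt_extChartAt_symm_of_mem ((extChartAt 𝓘(ℝ, E') x).map_source hz)).mdifferentiableAt
      (by simp)
  rw [← hz'', localForm_eq_pull, ← tderiv_eq_fderiv]
  exact (pull_pull α z h5 (h4.comp z hz')).symm

theorem extChartAt_comp_contDiffAt {g : E → M'} {y : E} (x : M')
    (hg : ContMDiffAt 𝓘(ℝ, E) 𝓘(ℝ, E') ∞ g y) (hx : g y ∈ (extChartAt 𝓘(ℝ, E') x).source) :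
    ContDiffAt ℝ ∞ (fun z => extChartAt 𝓘(ℝ, E') x (g z)) y := by
  rw [extChartAt_source] at hx
  exact ((contMDiffAt_extChartAt' hx).comp y hg).contDiffAt

theorem IsSmooth.contDiffAt_pull {α : FormField E' M' k} (hα : IsSmooth α) {g : E → M'} {y : E}
    (hg : ContMDiffAt 𝓘(ℝ, E) 𝓘(ℝ, E') ∞ g y) :
    ContDiffAt ℝ ∞ (pull g α : E → E [⋀^Fin k]→L[ℝ] ℝ) y := by
  have hx := mem_extChartAt_source (I := 𝓘(ℝ, E')) (g y)
  refine ContDiffAt.congr_of_eventuallyEq ?_ (eventually_pull_eq (g y) hg hx)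
  have h := extChartAt_comp_contDiffAt (g y) hg hx
  refine contDiffAt_compContinuousLinearMap ?_ (h.fderiv_right (m := ∞) (by simp))
  refine ContDiffAt.comp (g := localForm α (g y)) y ?_ h
  exact (hα (g y)).contDiffAt (extChartAt_target_mem_nhds (g y))

/-- Naturality of d. Only the preferred chart at `g y` matters, since that is the chart in which
`extD` is computed there. With `g` an inverse chart, this identifies the local form of dα with the
exterior derivative of the local form of α, and shows that `extD` does not depend on the chart. -/
theorem IsSmooth.extDeriv_pull {α : FormField E' M' k} (hα : IsSmooth α) {g : E → M'} {y : E}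
    (hg : ContMDiffAt 𝓘(ℝ, E) 𝓘(ℝ, E') ∞ g y) :
    extDeriv (pull g α : E → E [⋀^Fin k]→L[ℝ] ℝ) y =
      (pull g (extD α) : E → E [⋀^Fin (k + 1)]→L[ℝ] ℝ) y := by
  have hx := mem_extChartAt_source (I := 𝓘(ℝ, E')) (g y)
  have h := extChartAt_comp_contDiffAt (g y) hg hx
  have h1 : ContDiffAt ℝ ∞ (localForm α (g y)) (extChartAt 𝓘(ℝ, E') (g y) (g y)) :=
    (hα (g y)).contDiffAt (extChartAt_target_mem_nhds (g y))
  rw [(eventually_pull_eq (g y) hg hx).extDeriv_eq,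
    extDeriv_pullback (f := fun z => extChartAt 𝓘(ℝ, E') (g y) (g z)) (r := ∞)
      (h1.differentiableAt (by simp)) h two_le_infty]
  ext v
  have h4 : MDifferentiableAt 𝓘(ℝ, E') 𝓘(ℝ, E') (extChartAt 𝓘(ℝ, E') (g y)) (g y) :=
    mdifferentiableAt_extChartAt (mem_chart_source _ _)
  rw [← tderiv_eq_fderiv]
  erw [tderiv_comp (g := extChartAt 𝓘(ℝ, E') (g y)) y h4 (hg.mdifferentiableAt (by simp))]
  rfl

theorem IsSmooth.extD {α : FormField E M k} (hα : IsSmooth α) : IsSmooth (extD α) := by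
  intro x y hy
  have hg : ∀ z ∈ (extChartAt 𝓘(ℝ, E) x).target,
      ContMDiffAt 𝓘(ℝ, E) 𝓘(ℝ, E) ∞ (extChartAt 𝓘(ℝ, E) x).symm z :=
    fun z hz => contMDiffAt_extChartAt_symm_of_mem hz
  have h : extDeriv (localForm α x) =ᶠ[𝓝 y] localForm (Multisymplectic.extD α) x := by
    filter_upwards [(isOpen_extChartAt_target x).mem_nhds hy] with z hz
    exact hα.extDeriv_pull (hg z hz)
  refine (ContDiffAt.congr_of_eventuallyEq ?_ h.symm).contDiffWithinAt
  exact contDiffAt_extDeriv (hα.contDiffAt_pull (hg y hy))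

theorem IsSmooth.extD_extD {α : FormField E M k} (hα : IsSmooth α) :
    Multisymplectic.extD (Multisymplectic.extD α) = 0 := by
  funext x
  have h : extDeriv (localForm α x) =ᶠ[𝓝 (extChartAt 𝓘(ℝ, E) x x)]
      localForm (Multisymplectic.extD α) x := by
    filter_upwards [extChartAt_target_mem_nhds x] with z hz
    exact hα.extDeriv_pull (contMDiffAt_extChartAt_symm_of_mem hz)
  rw [extD_eq, ← h.extDeriv_eq, extDeriv_extDeriv_apply (r := ∞)
    ((hα x).contDiffAt (extChartAt_target_mem_nhds x)) two_le_infty]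
  rfl

end Pull

/-! ### Local constancy from vanishing derivatives -/

section Constancy

variable {E : Type*} [NormedAddCommGroup E] [NormedSpace ℝ E]
  {E' : Type*} [NormedAddCommGroup E'] [NormedSpace ℝ E']
  {M' : Type*} [TopologicalSpace M'] [ChartedSpace E' M'] [IsManifold 𝓘(ℝ, E') ∞ M']

theorem eventually_eq_of_fderiv_eq_zero {f : E → E'} {y : E}
    (hf : ∀ᶠ z in 𝓝 y, HasFDerivAt f (0 : E →L[ℝ] E') z) : ∀ᶠ z in 𝓝 y, f z = f y := by
  obtain ⟨ε, hε, h⟩ := Metric.eventually_nhds_iff_ball.1 hf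
  filter_upwards [Metric.ball_mem_nhds y hε] with z hz
  exact Metric.isOpen_ball.is_const_of_fderiv_eq_zero (convex_ball y ε).isPreconnected
    (fun w hw => (h w hw).differentiableAt.differentiableWithinAt) (fun w hw => (h w hw).fderiv)
    hz (Metric.mem_ball_self hε)

theorem eventually_eq_of_tderiv_eq_zero {f : E → M'} {y : E}
    (hf : ∀ᶠ z in 𝓝 y, MDifferentiableAt 𝓘(ℝ, E) 𝓘(ℝ, E') f z)
    (h0 : ∀ᶠ z in 𝓝 y, tderiv E E' f z = 0) : ∀ᶠ z in 𝓝 y, f z = f y := by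
  have hsrc : ∀ᶠ z in 𝓝 y, f z ∈ (extChartAt 𝓘(ℝ, E') (f y)).source :=
    hf.self_of_nhds.continuousAt.eventually (extChartAt_source_mem_nhds (f y))
  have h1 : ∀ᶠ z in 𝓝 y,
      HasFDerivAt (fun z => extChartAt 𝓘(ℝ, E') (f y) (f z)) (0 : E →L[ℝ] E') z := by
    filter_upwards [hf, h0, hsrc] with z hz hz0 hzs
    have h4 : MDifferentiableAt 𝓘(ℝ, E') 𝓘(ℝ, E') (extChartAt 𝓘(ℝ, E') (f y)) (f z) :=
      mdifferentiableAt_extChartAt (by rwa [extChartAt_source] at hzs)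
    have h5 := (h4.comp z hz).differentiableAt.hasFDerivAt
    rw [← tderiv_eq_fderiv, tderiv_comp z h4 hz, hz0, ContinuousLinearMap.comp_zero] at h5
    exact h5
  filter_upwards [eventually_eq_of_fderiv_eq_zero h1, hsrc] with z hz hzs
  exact (extChartAt 𝓘(ℝ, E') (f y)).injOn hzs (mem_extChartAt_source _) hz

/-- Cartan's formula for the constant field `a`: both ι_a dβ and ι_a β vanish. Concretely, in dβ(a,
v) every term but the first differentiates a function in which `a` still occupies slot 0. -/
theorem fderiv_apply_eq_zero_of_extDeriv_eq_zero {m : ℕ} {β : E → E [⋀^Fin (m + 1)]→L[ℝ] ℝ}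
    {p a : E} (hd : DifferentiableAt ℝ β p) (h0 : extDeriv β p = 0)
    (ha : ∀ᶠ q in 𝓝 p, ∀ v : Fin (m + 1) → E, v 0 = a → β q v = 0) : fderiv ℝ β p a = 0 := by
  ext v
  let w : Fin (m + 2) → E := Fin.cons a v
  have h1 : extDeriv β p w = 0 := by
    rw [h0]
    rfl
  rw [extDeriv_apply hd, Fin.sum_univ_succ] at h1
  have h2 : ∀ j : Fin (m + 1), fderiv ℝ (β · (j.succ.removeNth w)) p (w j.succ) = 0 := by
    intro j
    have h3 : (β · (j.succ.removeNth w)) =ᶠ[𝓝 p] fun _ => (0 : ℝ) := by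
      filter_upwards [ha] with q hq
      refine hq _ ?_
      simp [w, Fin.removeNth]
    rw [h3.fderiv_eq]
    simp
  simp only [h2, smul_zero, Finset.sum_const_zero, add_zero] at h1
  rw [fderiv_continuousAlternatingMap_apply_const_apply hd] at h1
  simpa [w, Fin.removeNth] using h1

end Constancy

/-! ### Smooth actions -/

section Action

variable {F : Type*} [NormedAddCommGroup F] [NormedSpace ℝ F]
  {E : Type*} [NormedAddCommGroup E] [NormedSpace ℝ E]
  {G : Type*} [Group G] [TopologicalSpace G] [ChartedSpace F G] 
  {N : Type*} [TopologicalSpace N] [ChartedSpace E N]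
  [MulAction G N] [ContMDiffSMul 𝓘(ℝ, F) 𝓘(ℝ, E) ∞ G N]

theorem contMDiff_orbit (x : N) : ContMDiff 𝓘(ℝ, F) 𝓘(ℝ, E) ∞ (fun g : G => g • x) :=
  (contMDiff_smul (I := 𝓘(ℝ, F)) (I' := 𝓘(ℝ, E)) (n := ∞) (G := G) (M := N)).comp
    (contMDiff_id.prodMk contMDiff_const)

variable (E) in
/-- The derivative at `1` of the orbit map `g ↦ g • x`: the value of a fundamental field at `x`. -/
def orbitDeriv (F : Type*) [NormedAddCommGroup F] [NormedSpace ℝ F]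
    (G : Type*) [Group G] [TopologicalSpace G] [ChartedSpace F G] [MulAction G N] (x : N) :
    F →L[ℝ] E :=
  tderiv F E (fun g : G => g • x) 1

variable [LieGroup 𝓘(ℝ, F) ∞ G]

/-- Since h • x = (h g⁻¹) • (g • x), derivatives of an orbit map at any `g` are values of
fundamental fields at `g • x`. -/
theorem tderiv_orbit (x : N) (g : G) :
    tderiv F E (fun h : G => h • x) g =
      (orbitDeriv E F G (g • x)).comp (tderiv F F (fun h : G => h * g⁻¹) g) := by
  have h1 : (fun h : G => h • x) = (fun h : G => h • (g • x)) ∘ (fun h : G => h * g⁻¹) := by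
    funext h
    simp [smul_smul]
  have h2 := tderiv_comp (g := fun h : G => h • (g • x)) (f := fun h : G => h * g⁻¹) g
    ((contMDiff_orbit (F := F) (E := E) (g • x)).mdifferentiable (by simp) _)
    ((contMDiff_mul_right (I := 𝓘(ℝ, F)) (n := ∞) (a := g⁻¹)).mdifferentiable (by simp) _)
  rw [← h1, mul_inv_cancel] at h2
  exact h2

theorem tderiv_orbit_comp_left (x : N) (g : G) :
    (tderiv F E (fun h : G => h • x) g).comp (tderiv F F (fun h : G => g * h) 1) =
      (tderiv E E (fun y : N => g • y) x).comp (orbitDeriv E F G x) := by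
  have h1 : (fun h : G => h • x) ∘ (fun h : G => g * h) = (fun y : N => g • y) ∘
      (fun h : G => h • x) := by
    funext h
    simp [smul_smul]
  have h2 := tderiv_comp (g := fun h : G => h • x) (f := fun h : G => g * h) 1
    ((contMDiff_orbit (F := F) (E := E) x).mdifferentiable (by simp) _)
    ((contMDiff_mul_left (I := 𝓘(ℝ, F)) (n := ∞) (a := g)).mdifferentiable (by simp) _)
  have h3 := tderiv_comp (g := fun y : N => g • y) (f := fun h : G => h • x) 1
    ((ContMDiffSMul.contMDiff_const_smul (I := 𝓘(ℝ, F)) (I' := 𝓘(ℝ, E)) (n := ∞) g).mdifferentiable (by simp) _)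
    ((contMDiff_orbit (F := F) (E := E) x).mdifferentiable (by simp) _)
  rw [mul_one] at h2
  rw [one_smul] at h3
  exact h2.symm.trans ((congrArg (tderiv F E · 1) h1).trans h3)

/-- Let γ be an integral curve through 1 of the left-invariant field of ξ. If ξ is in the kernel,
equivariance makes t ↦ γ(t) • x have zero derivative near 0, so it is constant there. By freeness γ
is then constantly 1 near 0, and ξ = γ'(0) = 0. -/
theorem orbitDeriv_injective [CompleteSpace F] [T2Space G] [IsManifold 𝓘(ℝ, E) ∞ N]
    (hfree : ∀ (g : G) (x : N), g • x = x → g = 1) (x : N) :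
    Function.Injective (orbitDeriv E F G x) := by
  refine (injective_iff_map_eq_zero _).2 fun ξ hξ => ?_
  have : LieGroup 𝓘(ℝ, F) (minSmoothness ℝ 3) G := by
    rw [minSmoothness_of_isRCLikeNormedField]
    infer_instance
  have : IsManifold 𝓘(ℝ, F) ∞ G := LieGroup.toContMDiffMul.toIsManifold
  obtain ⟨γ, hγ0, hγ⟩ := exists_isMIntegralCurveAt_of_contMDiffAt_boundaryless
    (I := 𝓘(ℝ, F)) (v := mulInvariantVectorField (I := 𝓘(ℝ, F)) (G := G) ξ) 0
    (x₀ := (1 : G)) ((contMDiffAt_mulInvariantVectorField ξ).of_le (by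
      rw [minSmoothness_of_isRCLikeNormedField]
      exact one_le_two))
  have hd : ∀ᶠ t in 𝓝 (0 : ℝ), MDifferentiableAt 𝓘(ℝ, ℝ) 𝓘(ℝ, F) γ t ∧
      ∀ c, tderiv ℝ F γ t c = c • tderiv F F (fun h : G => γ t * h) 1 ξ := by
    filter_upwards [hγ] with t ht
    exact ⟨ht.mdifferentiableAt, fun c => by rw [tderiv, ht.mfderiv]; rfl⟩
  have ho := (contMDiff_orbit (F := F) (E := E) (G := G) x).mdifferentiable (by simp)
  have h0 : ∀ᶠ t in 𝓝 (0 : ℝ), γ t • x = γ 0 • x := by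
    refine eventually_eq_of_tderiv_eq_zero (E' := E) (hd.mono fun t ht => ?_)
      (hd.mono fun t ht => ?_)
    · exact (ho (γ t)).comp t ht.1
    · refine (tderiv_comp t (ho (γ t)) ht.1).trans ?_
      ext
      have h := congrArg (· ξ) (tderiv_orbit_comp_left (F := F) (E := E) x (γ t))
      simp only [ContinuousLinearMap.comp_apply] at h
      rw [ContinuousLinearMap.comp_apply, ht.2, map_smul, h, hξ, map_zero, smul_zero]
      rfl
  have h1 : γ =ᶠ[𝓝 0] fun _ => (1 : G) := by
    filter_upwards [h0] with t ht
    rw [hγ0, one_smul] at ht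
    exact hfree _ _ ht
  have h2 := (hd.self_of_nhds).2 1
  rw [tderiv_congr h1, tderiv_const, hγ0, one_smul] at h2
  simp only [one_mul] at h2
  exact (h2.trans (congrArg (· ξ) (tderiv_id (1 : G)))).symm

/-- The map `g ↦ (g^* α)_y` is locally constant if `α` is closed and horizontal. -/
theorem isLocallyConstant_pull_translate [IsManifold 𝓘(ℝ, E) ∞ N] {m : ℕ}
    {α : FormField E N (m + 1)} (hα : IsSmooth α) (hcl : extD α = 0)
    (hhor : ∀ (x : N) (ξ : F) (v : Fin (m + 1) → E), v 0 = orbitDeriv E F G x ξ → α x v = 0)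
    (y : N) : IsLocallyConstant
      fun g : G => (pull (fun x : N => g • x) α : N → E [⋀^Fin (m + 1)]→L[ℝ] ℝ) y := by
  have : IsManifold 𝓘(ℝ, F) ∞ G := LieGroup.toContMDiffMul.toIsManifold
  refine (IsLocallyConstant.iff_eventually_eq _).2 fun g₀ => ?_
  set ψ := extChartAt 𝓘(ℝ, F) g₀ with hψ
  set φ := extChartAt 𝓘(ℝ, E) y with hφ
  -- `Q` is the action in coordinates. The form `β` is closed, and it vanishes on vectors (a, 0)
  -- because `Q` sends them to vertical ones. Hence it is constant in the group direction.
  let Q : F × E → N := fun p => ψ.symm p.1 • φ.symm p.2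
  let β : F × E → (F × E) [⋀^Fin (m + 1)]→L[ℝ] ℝ := pull Q α
  have hT : IsOpen (ψ.target ×ˢ φ.target) :=
    (isOpen_extChartAt_target g₀).prod (isOpen_extChartAt_target y)
  have hQ : ∀ p ∈ ψ.target ×ˢ φ.target, ContMDiffAt 𝓘(ℝ, F × E) 𝓘(ℝ, E) ∞ Q p := by
    intro p hp
    refine ContMDiffAt.smul (I := 𝓘(ℝ, F)) (I' := 𝓘(ℝ, E)) (f := fun p : F × E => ψ.symm p.1)
      (g := fun p : F × E => φ.symm p.2) ?_ ?_
    · exact (contMDiffAt_extChartAt_symm_of_mem hp.1).comp p contDiff_fst.contMDiff.contMDiffAt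
    · exact (contMDiffAt_extChartAt_symm_of_mem hp.2).comp p contDiff_snd.contMDiff.contMDiffAt
  have hβs : ∀ p ∈ ψ.target ×ˢ φ.target, ContDiffAt ℝ ∞ β p :=
    fun p hp => hα.contDiffAt_pull (hQ p hp)
  have hβ0 : ∀ p ∈ ψ.target ×ˢ φ.target, extDeriv β p = 0 := by
    intro p hp
    refine (hα.extDeriv_pull (hQ p hp)).trans ?_
    rw [hcl]
    rfl
  have hβh : ∀ p ∈ ψ.target ×ˢ φ.target, ∀ (a : F) (v : Fin (m + 1) → F × E), v 0 = (a, 0) →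
      β p v = 0 := by
    intro p hp a v hv
    refine hhor (Q p) (tderiv F F (fun h : G => h * (ψ.symm p.1)⁻¹) (ψ.symm p.1)
      (tderiv F F ψ.symm p.1 a)) _ ?_
    have h1 : Q ∘ (fun u : F => (u, p.2)) = (fun h : G => h • φ.symm p.2) ∘ ψ.symm := rfl
    have h2 := tderiv_comp (E := F) (E' := F × E) (E'' := E) (g := Q)
      (f := fun u : F => (u, p.2)) p.1
      ((hQ p hp).mdifferentiableAt (by simp))
      (by
        have : DifferentiableAt ℝ (fun u : F => (u, p.2)) p.1 := by fun_prop
        exact this.mdifferentiableAt)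
    have h3 := tderiv_comp (E := F) (E' := F) (E'' := E) (g := fun h : G => h • φ.symm p.2)
      (f := ψ.symm) p.1
      ((contMDiff_orbit (F := F) (E := E) (G := G) _).mdifferentiable (by simp) _)
      ((contMDiffAt_extChartAt_symm_of_mem hp.1).mdifferentiableAt (by simp))
    rw [h1, h3, tderiv_orbit] at h2
    have h4 := congrArg (· a) h2
    rw [tderiv_eq_fderiv, (hasFDerivAt_prodMk_left p.1 p.2).fderiv] at h4
    rw [hv]
    exact h4.symm
  have hderiv : ∀ p ∈ ψ.target ×ˢ φ.target, ∀ a : F, fderiv ℝ β p (a, 0) = 0 := by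
    intro p hp a
    exact fderiv_apply_eq_zero_of_extDeriv_eq_zero ((hβs p hp).differentiableAt (by simp))
      (hβ0 p hp) (by filter_upwards [hT.mem_nhds hp] with q hq using hβh q hq a)
  have hg₀ : ψ g₀ ∈ ψ.target := ψ.map_source (mem_extChartAt_source g₀)
  have hy : φ y ∈ φ.target := φ.map_source (mem_extChartAt_source y)
  have hconst : ∀ᶠ u in 𝓝 (ψ g₀), β (u, φ y) = β (ψ g₀, φ y) := by
    refine eventually_eq_of_fderiv_eq_zero (f := fun u => β (u, φ y)) ?_
    filter_upwards [(isOpen_extChartAt_target g₀).mem_nhds hg₀] with u hu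
    have h1 := HasFDerivAt.comp (f := fun u => (u, φ y)) u
      ((hβs (u, φ y) ⟨hu, hy⟩).differentiableAt (by simp)).hasFDerivAt
      (hasFDerivAt_prodMk_left (𝕜 := ℝ) u (φ y))
    have h2 : (fderiv ℝ β (u, φ y)).comp (ContinuousLinearMap.inl ℝ F E) = 0 := by
      ext1 a
      exact hderiv (u, φ y) ⟨hu, hy⟩ a
    rwa [h2] at h1
  have hcont : Tendsto ψ (𝓝 g₀) (𝓝 (ψ g₀)) := (continuousAt_extChartAt g₀).tendsto
  filter_upwards [hcont.eventually hconst, extChartAt_source_mem_nhds (I := 𝓘(ℝ, F)) g₀]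
    with g hg hgs
  -- The pullback by `g` at `y` is `β` at (ψ g, φ y) restricted to vectors (0, ·), so it inherits
  -- the constancy in the group variable.
  have key : ∀ g ∈ ψ.source, ∀ v,
      (pull (fun x : N => g • x) α : N → E [⋀^Fin (m + 1)]→L[ℝ] ℝ) y v =
      β (ψ g, φ y) (fun i => (0, tderiv E E φ y (v i))) := by
    intro g hg v
    have hgt := ψ.map_source hg
    have h0 : (fun x : N => g • x) =ᶠ[𝓝 y] Q ∘ (fun z : E => (ψ g, z)) ∘ φ := by
      filter_upwards [extChartAt_source_mem_nhds (I := 𝓘(ℝ, E)) y] with x hx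
      change g • x = ψ.symm (ψ g) • φ.symm (φ x)
      rw [ψ.left_inv hg, φ.left_inv hx]
    have hφd : MDifferentiableAt 𝓘(ℝ, E) 𝓘(ℝ, E) φ y :=
      mdifferentiableAt_extChartAt (mem_chart_source _ _)
    have hid : MDifferentiableAt 𝓘(ℝ, E) 𝓘(ℝ, F × E) (fun z : E => (ψ g, z)) (φ y) := by
      have : DifferentiableAt ℝ (fun z : E => (ψ g, z)) (φ y) := by fun_prop
      exact this.mdifferentiableAt
    have hQd : MDifferentiableAt 𝓘(ℝ, F × E) 𝓘(ℝ, E) Q (ψ g, φ y) :=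
      (hQ (ψ g, φ y) ⟨hgt, hy⟩).mdifferentiableAt (by simp)
    have h1 := tderiv_comp (E := E) (E' := F × E) (E'' := E) (g := Q)
      (f := (fun z : E => (ψ g, z)) ∘ φ) y hQd (hid.comp y hφd)
    rw [tderiv_comp (E' := E) y hid hφd, tderiv_eq_fderiv (fun z : E => (ψ g, z)),
      (hasFDerivAt_prodMk_right (ψ g) (φ y)).fderiv] at h1
    rw [(pull_congr (E := E) α h0).self_of_nhds]
    change α (Q (ψ g, φ y)) (fun i => tderiv E E (Q ∘ (fun z => (ψ g, z)) ∘ φ) y (v i)) = _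
    rw [h1]
    rfl
  ext v
  rw [key g hgs, key g₀ (mem_extChartAt_source g₀), hg]

theorem pull_translate_eq [IsManifold 𝓘(ℝ, E) ∞ N] [PreconnectedSpace G] {m : ℕ}
    {α : FormField E N (m + 1)} (hα : IsSmooth α) (hcl : extD α = 0)
    (hhor : ∀ (x : N) (ξ : F) (v : Fin (m + 1) → E), v 0 = orbitDeriv E F G x ξ → α x v = 0)
    (g : G) (y : N) :
    (pull (fun x : N => g • x) α : N → E [⋀^Fin (m + 1)]→L[ℝ] ℝ) y = α y := by
  rw [(isLocallyConstant_pull_translate hα hcl hhor y).apply_eq_of_preconnectedSpace g 1]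
  have h1 : (fun x : N => (1 : G) • x) = id := by
    funext x
    simp
  rw [h1]
  ext v
  change α y (fun i => tderiv E E (id : N → N) y (v i)) = _
  rw [tderiv_id]
  rfl

end Action

/-! ### Derivatives of charts -/

section Charts

variable {E : Type*} [NormedAddCommGroup E] [NormedSpace ℝ E]
  {M : Type*} [TopologicalSpace M] [ChartedSpace E M] [IsManifold 𝓘(ℝ, E) ∞ M]

theorem tderiv_extChartAt_symm_comp {x y : M} (hy : y ∈ (extChartAt 𝓘(ℝ, E) x).source) :
    (tderiv E E (extChartAt 𝓘(ℝ, E) x).symm (extChartAt 𝓘(ℝ, E) x y)).comp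
      (tderiv E E (extChartAt 𝓘(ℝ, E) x) y) = ContinuousLinearMap.id ℝ E := by
  have h1 : (extChartAt 𝓘(ℝ, E) x).symm ∘ (extChartAt 𝓘(ℝ, E) x) =ᶠ[𝓝 y] id := by
    filter_upwards [(isOpen_extChartAt_source x).mem_nhds hy] with z hz
    exact (extChartAt 𝓘(ℝ, E) x).left_inv hz
  rw [← tderiv_id (E := E) y, ← tderiv_congr h1]
  refine (tderiv_comp y ?_ ?_).symm
  · exact (contMDiffAt_extChartAt_symm_of_mem
      ((extChartAt 𝓘(ℝ, E) x).map_source hy)).mdifferentiableAt (by simp)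
  · exact mdifferentiableAt_extChartAt (by rwa [extChartAt_source] at hy)

theorem tderiv_extChartAt_comp_symm {x y : M} (hy : y ∈ (extChartAt 𝓘(ℝ, E) x).source) :
    (tderiv E E (extChartAt 𝓘(ℝ, E) x) y).comp
      (tderiv E E (extChartAt 𝓘(ℝ, E) x).symm (extChartAt 𝓘(ℝ, E) x y)) =
        ContinuousLinearMap.id ℝ E := by
  have hyt := (extChartAt 𝓘(ℝ, E) x).map_source hy
  have h1 : (extChartAt 𝓘(ℝ, E) x) ∘ (extChartAt 𝓘(ℝ, E) x).symm
      =ᶠ[𝓝 (extChartAt 𝓘(ℝ, E) x y)] id := by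
    filter_upwards [(isOpen_extChartAt_target x).mem_nhds hyt] with z hz
    exact (extChartAt 𝓘(ℝ, E) x).right_inv hz
  have h2 : MDifferentiableAt 𝓘(ℝ, E) 𝓘(ℝ, E) (extChartAt 𝓘(ℝ, E) x)
      ((extChartAt 𝓘(ℝ, E) x).symm (extChartAt 𝓘(ℝ, E) x y)) := by
    rw [(extChartAt 𝓘(ℝ, E) x).left_inv hy]
    exact mdifferentiableAt_extChartAt (by rwa [extChartAt_source] at hy)
  have h3 := tderiv_comp (E := E) (E' := E) (E'' := E) (extChartAt 𝓘(ℝ, E) x y) h2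
    ((contMDiffAt_extChartAt_symm_of_mem hyt).mdifferentiableAt (by simp))
  rw [(extChartAt 𝓘(ℝ, E) x).left_inv hy] at h3
  rw [← h3, tderiv_congr h1, tderiv_id]

end Charts

/-! ### Inverse function theorem and linear complements -/

section InverseFunction

variable {X Y : Type*} [NormedAddCommGroup X] [NormedSpace ℝ X] [CompleteSpace X]
  [NormedAddCommGroup Y] [NormedSpace ℝ Y]

/-- The inverse function theorem, with an inverse that is smooth on its whole domain. -/
theorem exists_openPartialHomeomorph_contDiffAt_symm {f : X → Y} {T : Set X} (hT : IsOpen T)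
    {a : X} (ha : a ∈ T) (hf : ∀ x ∈ T, ContDiffAt ℝ ∞ f x) {f' : X ≃L[ℝ] Y}
    (hf' : HasFDerivAt f (f' : X →L[ℝ] Y) a) :
    ∃ e : OpenPartialHomeomorph X Y, (∀ x, e x = f x) ∧ a ∈ e.source ∧ e.source ⊆ T ∧
      ∀ y ∈ e.target, ContDiffAt ℝ ∞ e.symm y := by
  let e₀ := (hf a ha).toOpenPartialHomeomorph f hf' (by simp)
  have hcont : ContinuousAt (fderiv ℝ f) a :=
    ((hf a ha).fderiv_right (m := 0) (by simp)).continuousAt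
  -- Invertible linear maps form an open set, so the derivative remains invertible near `a`.
  -- Restricting to such points makes the inverse smooth on its entire domain.
  have hev : ∀ᶠ x in 𝓝 a, x ∈ T ∧ fderiv ℝ f x ∈ range ((↑) : (X ≃L[ℝ] Y) → X →L[ℝ] Y) := by
    refine Filter.Eventually.and (hT.mem_nhds ha) (hcont.eventually ?_)
    rw [hf'.fderiv]
    exact ContinuousLinearEquiv.nhds f'
  obtain ⟨U, hU, hUo, haU⟩ := eventually_nhds_iff.1 hev
  refine ⟨e₀.restrOpen U hUo, fun x => rfl, ⟨?_, haU⟩, fun x hx => (hU x hx.2).1,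
    fun y hy => ?_⟩
  · exact (hf a ha).mem_toOpenPartialHomeomorph_source hf' (by simp)
  · have hs := (e₀.restrOpen U hUo).map_target hy
    obtain ⟨hxT, f₁, hf₁⟩ := hU _ hs.2
    refine (e₀.restrOpen U hUo).contDiffAt_symm (f₀' := f₁) hy ?_ (hf _ hxT)
    rw [hf₁]
    exact ((hf _ hxT).differentiableAt (by simp)).hasFDerivAt

end InverseFunction

/-- A parametrized complement of the range of `P`. For `P` the derivative of an orbit map, `A` gives
the directions of the slice. -/
theorem exists_coprod_equiv {X Y : Type*} [NormedAddCommGroup X] [NormedSpace ℝ X]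
    [FiniteDimensional ℝ X] [NormedAddCommGroup Y] [NormedSpace ℝ Y] [FiniteDimensional ℝ Y]
    {P : X →L[ℝ] Y} (hP : Function.Injective P) {q : ℕ}
    (hq : q + Module.finrank ℝ X = Module.finrank ℝ Y) :
    ∃ (A : EuclideanSpace ℝ (Fin q) →L[ℝ] Y) (L : (X × EuclideanSpace ℝ (Fin q)) ≃L[ℝ] Y),
      (L : (X × EuclideanSpace ℝ (Fin q)) →L[ℝ] Y) = P.coprod A := by
  obtain ⟨C, hC⟩ := Submodule.exists_isCompl (LinearMap.range (P : X →ₗ[ℝ] Y))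
  have h1 := Submodule.finrank_add_eq_of_isCompl hC
  rw [LinearMap.finrank_range_of_inj hP] at h1
  have h2 : Module.finrank ℝ (EuclideanSpace ℝ (Fin q)) = Module.finrank ℝ C := by
    rw [finrank_euclideanSpace_fin]
    omega
  let A₀ : EuclideanSpace ℝ (Fin q) ≃ₗ[ℝ] C := LinearEquiv.ofFinrankEq _ _ h2
  let A : EuclideanSpace ℝ (Fin q) →L[ℝ] Y := LinearMap.toContinuousLinearMap (C.subtype ∘ₗ A₀)
  have hinj : Function.Injective (P.coprod A) := by
    refine (injective_iff_map_eq_zero _).2 fun ⟨a, b⟩ hab => ?_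
    have hab' : P a + (A₀ b : Y) = 0 := hab
    have hmem : P a ∈ LinearMap.range (P : X →ₗ[ℝ] Y) ⊓ C := by
      refine ⟨⟨a, rfl⟩, ?_⟩
      rw [eq_neg_of_add_eq_zero_left hab']
      exact C.neg_mem (A₀ b).2
    rw [hC.inf_eq_bot, Submodule.mem_bot] at hmem
    rw [hmem, zero_add] at hab'
    have ha : a = 0 := hP (by rw [hmem, map_zero])
    have hb : b = 0 := A₀.injective (by rw [map_zero]; exact Subtype.ext hab')
    rw [ha, hb]
    rfl
  have hfin : Module.finrank ℝ (X × EuclideanSpace ℝ (Fin q)) = Module.finrank ℝ Y := by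
    rw [Module.finrank_prod, finrank_euclideanSpace_fin]
    omega
  refine ⟨A, (LinearEquiv.ofInjectiveOfFinrankEq ((P.coprod A : _ →L[ℝ] Y) : _ →ₗ[ℝ] Y) hinj
    hfin).toContinuousLinearEquiv, ?_⟩
  ext x <;> rfl

/-! ### Slices of free proper actions -/

section Slice

variable {F : Type*} [NormedAddCommGroup F] [NormedSpace ℝ F] [FiniteDimensional ℝ F]
  {E : Type*} [NormedAddCommGroup E] [NormedSpace ℝ E] [FiniteDimensional ℝ E]
  {G : Type*} [Group G] [TopologicalSpace G] [ChartedSpace F G] [LieGroup 𝓘(ℝ, F) ∞ G] [T2Space G]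
  {N : Type*} [TopologicalSpace N] [ChartedSpace E N] [IsManifold 𝓘(ℝ, E) ∞ N]
  [MulAction G N] [ContMDiffSMul 𝓘(ℝ, F) 𝓘(ℝ, E) ∞ G N]

/-- Properness makes (g, y) ↦ (g • y, y) a closed map. The image of the group elements outside the
interior of `O` is thus closed, and by freeness it misses (x, x), hence also a product neighbourhood
of it. -/
theorem eventually_mem_of_smul_near {G N : Type*} [Group G] [TopologicalSpace G]
    [TopologicalSpace N] [MulAction G N] [ProperSMul G N]
    (hfree : ∀ (g : G) (x : N), g • x = x → g = 1) {O : Set G} (hO : O ∈ 𝓝 (1 : G)) (x : N) :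
    ∃ V : Set N, IsOpen V ∧ x ∈ V ∧ ∀ (g : G), ∀ y ∈ V, g • y ∈ V → g ∈ O := by
  have hcl : IsClosed ((fun gx : G × N => (gx.1 • gx.2, gx.2)) '' ((interior O)ᶜ ×ˢ univ)) :=
    ProperSMul.isProperMap_smul_pair.isClosedMap _
      (isOpen_interior.isClosed_compl.prod isClosed_univ)
  have hx : (x, x) ∈ ((fun gx : G × N => (gx.1 • gx.2, gx.2)) '' ((interior O)ᶜ ×ˢ univ))ᶜ := by
    rintro ⟨⟨g, y⟩, ⟨hg, -⟩, h⟩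
    obtain ⟨h1, rfl⟩ := Prod.mk.inj h
    rw [hfree g y h1] at hg
    exact hg (mem_interior_iff_mem_nhds.2 hO)
  obtain ⟨V₁, V₂, hV₁, hV₂, hx₁, hx₂, hV⟩ := isOpen_prod_iff.1 hcl.isOpen_compl x x hx
  refine ⟨V₁ ∩ V₂, hV₁.inter hV₂, ⟨hx₁, hx₂⟩, fun g y hy hgy => ?_⟩
  by_contra hg
  exact hV (mk_mem_prod hgy.1 hy.2)
    ⟨(g, y), ⟨fun h => hg (interior_subset h), mem_univ _⟩, rfl⟩

variable (F) in
/-- A slice through `x₀` for a free and proper action, with its associated invariant coordinates. -/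
theorem exists_slice [ProperSMul G N] (hfree : ∀ (g : G) (x : N), g • x = x → g = 1) {q : ℕ}
    (hq : q + Module.finrank ℝ F = Module.finrank ℝ E) (x₀ : N) :
    ∃ (S : Set (EuclideanSpace ℝ (Fin q))) (W : Set N) (slice : EuclideanSpace ℝ (Fin q) → N)
      (coord : N → EuclideanSpace ℝ (Fin q)),
      IsOpen S ∧ IsOpen W ∧ x₀ ∈ W ∧
      (∀ s ∈ S, ContMDiffAt 𝓘(ℝ, EuclideanSpace ℝ (Fin q)) 𝓘(ℝ, E) ∞ slice s) ∧
      (∀ x ∈ W, ContMDiffAt 𝓘(ℝ, E) 𝓘(ℝ, EuclideanSpace ℝ (Fin q)) ∞ coord x) ∧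
      (∀ s ∈ S, slice s ∈ W ∧ coord (slice s) = s) ∧
      (∀ x ∈ W, coord x ∈ S ∧ ∃ g : G, x = g • slice (coord x)) ∧
      (∀ s₁ ∈ S, ∀ s₂ ∈ S, ∀ g : G, g • slice s₁ = slice s₂ → s₁ = s₂) := by
  have : IsManifold 𝓘(ℝ, F) ∞ G := LieGroup.toContMDiffMul.toIsManifold
  set ψ := extChartAt 𝓘(ℝ, F) (1 : G) with hψ
  set φ := extChartAt 𝓘(ℝ, E) x₀ with hφ
  have h1s : (1 : G) ∈ ψ.source := mem_extChartAt_source 1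
  have hx₀s : x₀ ∈ φ.source := mem_extChartAt_source x₀
  have h1t : ψ 1 ∈ ψ.target := ψ.map_source h1s
  have hx₀t : φ x₀ ∈ φ.target := φ.map_source hx₀s
  have hψ1 : ψ.symm (ψ 1) = 1 := ψ.left_inv h1s
  have hφx₀ : φ.symm (φ x₀) = x₀ := φ.left_inv hx₀s
  have hφd : MDifferentiableAt 𝓘(ℝ, E) 𝓘(ℝ, E) φ x₀ :=
    mdifferentiableAt_extChartAt (mem_chart_source _ _)
  have hψd : MDifferentiableAt 𝓘(ℝ, F) 𝓘(ℝ, F) ψ.symm (ψ 1) :=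
    (contMDiffAt_extChartAt_symm_of_mem h1t).mdifferentiableAt (by simp)
  let P : F →L[ℝ] E := (tderiv E E φ x₀).comp ((orbitDeriv E F G x₀).comp
    (tderiv F F ψ.symm (ψ 1)))
  have hP : Function.Injective P := by
    refine Function.Injective.comp (f := (orbitDeriv E F G x₀).comp (tderiv F F ψ.symm (ψ 1))) ?_
      (Function.Injective.comp (g := orbitDeriv E F G x₀) (orbitDeriv_injective hfree x₀) ?_)
    · exact Function.LeftInverse.injective
        (fun v => congrArg (· v) (tderiv_extChartAt_symm_comp hx₀s))
    · exact Function.LeftInverse.injective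
        (fun v => congrArg (· v) (tderiv_extChartAt_comp_symm h1s))
  obtain ⟨A, L, hL⟩ := exists_coprod_equiv hP hq
  -- In the chart at `x₀`, the slice is the affine subspace through `x₀` complementary to the orbit.
  -- The map `Q` below sweeps it out by the group, and `f`, which is `Q` in coordinates, has
  -- invertible derivative `L` at `a`.
  let slice : EuclideanSpace ℝ (Fin q) → N := fun s => φ.symm (φ x₀ + A s)
  let Q : F × EuclideanSpace ℝ (Fin q) → N := fun p => ψ.symm p.1 • slice p.2
  let f : F × EuclideanSpace ℝ (Fin q) → E := fun p => φ (Q p)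
  have hslice : ∀ s, φ x₀ + A s ∈ φ.target →
      ContMDiffAt 𝓘(ℝ, EuclideanSpace ℝ (Fin q)) 𝓘(ℝ, E) ∞ slice s := fun s hs =>
    ContMDiffAt.comp (g := φ.symm) s (contMDiffAt_extChartAt_symm_of_mem hs)
      (contDiff_const.add A.contDiff).contMDiff.contMDiffAt
  have hslice0 : slice 0 = x₀ := by
    change φ.symm (φ x₀ + A 0) = x₀
    rw [map_zero, add_zero, hφx₀]
  let T₀ : Set (F × EuclideanSpace ℝ (Fin q)) := {p | p.1 ∈ ψ.target ∧ φ x₀ + A p.2 ∈ φ.target}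
  have hT₀ : IsOpen T₀ :=
    ((isOpen_extChartAt_target (1 : G)).preimage continuous_fst).inter
      ((isOpen_extChartAt_target x₀).preimage (by fun_prop))
  have hQ : ∀ p ∈ T₀,
      ContMDiffAt 𝓘(ℝ, F × EuclideanSpace ℝ (Fin q)) 𝓘(ℝ, E) ∞ Q p := by
    intro p hp
    refine ContMDiffAt.smul (I := 𝓘(ℝ, F)) (I' := 𝓘(ℝ, E)) (g := fun p => slice p.2)
      (f := fun p : F × EuclideanSpace ℝ (Fin q) => ψ.symm p.1) ?_ ?_
    · exact (contMDiffAt_extChartAt_symm_of_mem hp.1).comp p contDiff_fst.contMDiff.contMDiffAt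
    · exact (hslice _ hp.2).comp p contDiff_snd.contMDiff.contMDiffAt
  let T := T₀ ∩ Q ⁻¹' φ.source
  have hT : IsOpen T :=
    ContinuousOn.isOpen_inter_preimage (fun p hp => (hQ p hp).continuousAt.continuousWithinAt)
      hT₀ (isOpen_extChartAt_source x₀)
  have hf : ∀ p ∈ T, ContDiffAt ℝ ∞ f p := fun p hp =>
    extChartAt_comp_contDiffAt x₀ (hQ p hp.1) hp.2
  let a : F × EuclideanSpace ℝ (Fin q) := (ψ 1, 0)
  have hQa : Q a = x₀ := by
    change ψ.symm (ψ 1) • slice 0 = x₀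
    rw [hψ1, hslice0, one_smul]
  have ha : a ∈ T := by
    refine ⟨⟨h1t, ?_⟩, ?_⟩
    · change φ x₀ + A 0 ∈ φ.target
      rwa [map_zero, add_zero]
    · change Q a ∈ φ.source
      rwa [hQa]
  have hfd := ((hf a ha).differentiableAt (by simp)).hasFDerivAt
  have hfa : HasFDerivAt f (L : F × EuclideanSpace ℝ (Fin q) →L[ℝ] E) a := by
    have hl : (fderiv ℝ f a).comp (ContinuousLinearMap.inl ℝ F (EuclideanSpace ℝ (Fin q))) = P := by
      have h1 := HasFDerivAt.comp (f := fun u => (u, (0 : EuclideanSpace ℝ (Fin q)))) (ψ 1) hfd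
        (hasFDerivAt_prodMk_left (𝕜 := ℝ) (ψ 1) 0)
      rw [← h1.fderiv, ← tderiv_eq_fderiv]
      have h2 : f ∘ (fun u => (u, (0 : EuclideanSpace ℝ (Fin q)))) =
          φ ∘ (fun g : G => g • x₀) ∘ ψ.symm := by
        funext u
        change φ (ψ.symm u • slice 0) = φ (ψ.symm u • x₀)
        rw [hslice0]
      have h4 := (contMDiff_orbit (F := F) (E := E) (G := G) x₀).mdifferentiable (by simp)
        (ψ.symm (ψ 1))
      have h3 := tderiv_comp (E := F) (E' := F) (E'' := E) (ψ 1) h4 hψd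
      have h6 : ((fun g : G => g • x₀) ∘ ψ.symm) (ψ 1) = x₀ := by
        change ψ.symm (ψ 1) • x₀ = x₀
        rw [hψ1, one_smul]
      have h5 := tderiv_comp (E := F) (E' := E) (E'' := E) (g := φ) (ψ 1)
        (by rw [h6]; exact hφd) (h4.comp (ψ 1) hψd)
      rw [h2, h5, h3, h6, hψ1]
      rfl
    have hr : (fderiv ℝ f a).comp (ContinuousLinearMap.inr ℝ F (EuclideanSpace ℝ (Fin q))) = A := by
      have h1 := HasFDerivAt.comp (f := fun s => (ψ 1, s)) (0 : EuclideanSpace ℝ (Fin q)) hfd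
        (hasFDerivAt_prodMk_right (𝕜 := ℝ) (ψ 1) 0)
      have hev : ∀ᶠ s in 𝓝 (0 : EuclideanSpace ℝ (Fin q)), φ x₀ + A s ∈ φ.target := by
        refine (Continuous.continuousAt (by fun_prop)).eventually
          ((isOpen_extChartAt_target x₀).mem_nhds ?_)
        rwa [map_zero, add_zero]
      have h2 : (f ∘ fun s => (ψ 1, s)) =ᶠ[𝓝 0] fun s => φ x₀ + A s := by
        filter_upwards [hev] with s hs
        change φ (ψ.symm (ψ 1) • φ.symm (φ x₀ + A s)) = _
        rw [hψ1, one_smul, φ.right_inv hs]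
      exact (h1.congr_of_eventuallyEq h2.symm).unique (A.hasFDerivAt.const_add (φ x₀))
    have h : P.coprod A = fderiv ℝ f a := by
      rw [← hl, ← hr]
      ext x
      · change fderiv ℝ f a (x, 0) + fderiv ℝ f a (0, 0) = fderiv ℝ f a (x, 0)
        rw [← map_add]
        simp
      · change fderiv ℝ f a (0, 0) + fderiv ℝ f a (0, x) = fderiv ℝ f a (0, x)
        rw [← map_add]
        simp
    rw [hL, h]
    exact hfd
  obtain ⟨e, hef, hae, heT, hes⟩ := exists_openPartialHomeomorph_contDiffAt_symm hT ha hf hfa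
  let W₀ := φ.source ∩ φ ⁻¹' e.target
  have hW₀ : IsOpen W₀ :=
    (continuousOn_extChartAt x₀).isOpen_inter_preimage (isOpen_extChartAt_source x₀) e.open_target
  let τ : N → F × EuclideanSpace ℝ (Fin q) := fun x => e.symm (φ x)
  have hτ : ∀ x ∈ W₀, ContMDiffAt 𝓘(ℝ, E) 𝓘(ℝ, F × EuclideanSpace ℝ (Fin q)) ∞ τ x :=
    fun x hx => (hes _ hx.2).contMDiffAt.comp x
      (contMDiffAt_extChartAt' (by rw [← extChartAt_source 𝓘(ℝ, E)]; exact hx.1))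
  have hQτ : ∀ x ∈ W₀, Q (τ x) = x := fun x hx => by
    have h1 := e.map_target hx.2
    refine φ.injOn (heT h1).2 hx.1 ?_
    change f (τ x) = φ x
    rw [← hef]
    exact e.right_inv hx.2
  have hQW : ∀ p ∈ e.source, Q p ∈ W₀ ∧ τ (Q p) = p := fun p hp => by
    have h1 : φ (Q p) = e p := (hef p).symm
    refine ⟨⟨(heT hp).2, ?_⟩, ?_⟩
    · change φ (Q p) ∈ e.target
      rw [h1]
      exact e.map_source hp
    · change e.symm (φ (Q p)) = p
      rw [h1, e.left_inv hp]
  -- `Q` is injective on `U ×ˢ S₁`. Shrinking the slice into `V` forces any `g` that relates two of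
  -- its points to have coordinate in `U`, so local injectivity of `Q` excludes two slice points on
  -- one orbit.
  obtain ⟨U, S₁, hU, hS₁, h1U, h0S₁, hUS⟩ := isOpen_prod_iff.1 e.open_source _ _ hae
  have hO : ψ.source ∩ ψ ⁻¹' U ∈ 𝓝 (1 : G) :=
    inter_mem (extChartAt_source_mem_nhds 1) ((continuousAt_extChartAt 1).preimage_mem_nhds
      (hU.mem_nhds h1U))
  obtain ⟨V, hV, hx₀V, hVO⟩ := eventually_mem_of_smul_near hfree hO x₀
  have hS₁e : ∀ s ∈ S₁, (ψ 1, s) ∈ e.source := fun s hs => hUS (mk_mem_prod h1U hs)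
  have hQs : ∀ s, Q (ψ 1, s) = slice s := fun s => by
    change ψ.symm (ψ 1) • slice s = slice s
    rw [hψ1, one_smul]
  let S := S₁ ∩ slice ⁻¹' V
  have hS : IsOpen S := ContinuousOn.isOpen_inter_preimage (fun s hs =>
    (hslice s (heT (hS₁e s hs)).1.2).continuousAt.continuousWithinAt) hS₁ hV
  let coord : N → EuclideanSpace ℝ (Fin q) := fun x => (τ x).2
  refine ⟨S, W₀ ∩ coord ⁻¹' S, slice, coord, hS, ?_, ⟨?_, ?_⟩, fun s hs => ?_, fun x hx => ?_,
    fun s hs => ?_, fun x hx => ?_, fun s₁ hs₁ s₂ hs₂ g hg => ?_⟩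
  · exact ContinuousOn.isOpen_inter_preimage (fun x hx =>
      (continuous_snd.continuousAt.comp (hτ x hx).continuousAt).continuousWithinAt) hW₀ hS
  · rw [← hQa]
    exact (hQW a hae).1
  · change (τ x₀).2 ∈ S
    rw [← hQa, (hQW a hae).2]
    refine ⟨h0S₁, ?_⟩
    change slice 0 ∈ V
    rwa [hslice0]
  · exact hslice s (heT (hS₁e s hs.1)).1.2
  · exact contDiff_snd.contMDiff.contMDiffAt.comp x (hτ x hx.1)
  · have h1 := hQW _ (hS₁e s hs.1)
    rw [hQs] at h1
    have h2 : coord (slice s) = s := congrArg Prod.snd h1.2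
    refine ⟨⟨h1.1, ?_⟩, h2⟩
    change coord (slice s) ∈ S
    rwa [h2]
  · exact ⟨hx.2, ψ.symm (τ x).1, (hQτ x hx.1).symm⟩
  · have hgO : g ∈ ψ.source ∩ ψ ⁻¹' U := hVO g (slice s₁) hs₁.2 (by rw [hg]; exact hs₂.2)
    have h1 : Q (ψ g, s₁) = Q (ψ 1, s₂) := by
      rw [hQs, ← hg]
      change ψ.symm (ψ g) • slice s₁ = g • slice s₁
      rw [ψ.left_inv hgO.1]
    have h2 := congrArg τ h1
    rw [(hQW _ (hUS (mk_mem_prod hgO.2 hs₁.1))).2, (hQW _ (hS₁e s₂ hs₂.1)).2] at h2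
    exact congrArg Prod.snd h2

end Slice

/-! ### Charts of the orbit space -/

section Quotient

variable {E : Type*} [NormedAddCommGroup E] [NormedSpace ℝ E]
  {B : Type*} [NormedAddCommGroup B]
  {G : Type*} [Group G] {N : Type*} [MulAction G N]

theorem proj_eq_iff {x y : N} : proj G N x = proj G N y ↔ ∃ g : G, g • y = x := by
  rw [proj, Quotient.eq, MulAction.orbitRel_apply, MulAction.mem_orbit_iff]

theorem proj_smul (g : G) (x : N) : proj G N (g • x) = proj G N x := proj_eq_iff.2 ⟨g, rfl⟩

theorem proj_surjective : Function.Surjective (proj G N) := Quotient.mk_surjective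

variable [TopologicalSpace N]

theorem isOpenQuotientMap_proj [ContinuousConstSMul G N] : IsOpenQuotientMap (proj G N) :=
  MulAction.isOpenQuotientMap_quotientMk

/-- The chart of the orbit space given by a slice. -/
theorem exists_chart_of_slice [ContinuousConstSMul G N] {S : Set B} {W : Set N} {slice : B → N}
    {coord : N → B} (hS : IsOpen S) (hW : IsOpen W) (hslice : ContinuousOn slice S)
    (hcoord : ContinuousOn coord W) (hsc : ∀ s ∈ S, slice s ∈ W ∧ coord (slice s) = s)
    (hcs : ∀ x ∈ W, coord x ∈ S ∧ ∃ g : G, x = g • slice (coord x))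
    (hinj : ∀ s₁ ∈ S, ∀ s₂ ∈ S, ∀ g : G, g • slice s₁ = slice s₂ → s₁ = s₂) :
    ∃ c : OpenPartialHomeomorph (MulAction.orbitRel.Quotient G N) B,
      c.source = proj G N '' W ∧ c.target = S ∧ (∀ x ∈ W, c (proj G N x) = coord x) ∧
      ∀ s, c.symm s = proj G N (slice s) := by
  classical
  have hinv : ∀ x ∈ W, ∀ y ∈ W, proj G N y = proj G N x → coord y = coord x := by
    intro x hx y hy hyx
    obtain ⟨hxS, g, hg⟩ := hcs x hx
    obtain ⟨hyS, k, hk⟩ := hcs y hy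
    rw [hg, hk, proj_smul, proj_smul] at hyx
    obtain ⟨l, hl⟩ := proj_eq_iff.1 hyx
    exact (hinj _ hxS _ hyS l hl).symm
  have hex : ∃ f : MulAction.orbitRel.Quotient G N → B, ∀ x ∈ W, f (proj G N x) = coord x := by
    -- By `hinv` the choice of a representative in `W` is immaterial. The value outside the image of
    -- `W` is arbitrary.
    refine ⟨fun p => if h : ∃ x ∈ W, proj G N x = p then coord h.choose else coord p.out,
      fun x hx => ?_⟩
    have h : ∃ y ∈ W, proj G N y = proj G N x := ⟨x, hx, rfl⟩
    exact (dif_pos h).trans (hinv x hx _ h.choose_spec.1 h.choose_spec.2)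
  obtain ⟨f, hf⟩ := hex
  have hπ := isOpenQuotientMap_proj (G := G) (N := N)
  refine ⟨{
    toFun := f
    invFun := fun s => proj G N (slice s)
    source := proj G N '' W
    target := S
    map_source' := ?_
    map_target' := fun s hs => mem_image_of_mem _ (hsc s hs).1
    left_inv' := ?_
    right_inv' := fun s hs => by rw [hf _ (hsc s hs).1, (hsc s hs).2]
    open_source := hπ.isOpenMap _ hW
    open_target := hS
    continuousOn_toFun := ?_
    continuousOn_invFun := hπ.continuous.comp_continuousOn hslice }, rfl, rfl, hf, fun s => rfl⟩
  · rintro _ ⟨x, hx, rfl⟩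
    rw [hf x hx]
    exact (hcs x hx).1
  · rintro _ ⟨x, hx, rfl⟩
    obtain ⟨-, g, hg⟩ := hcs x hx
    rw [hf x hx]
    conv_rhs => rw [hg, proj_smul]
  · rintro _ ⟨x, hx, rfl⟩
    refine ContinuousAt.continuousWithinAt (hπ.continuousAt_comp_iff.1 ?_)
    refine (hcoord.continuousAt (hW.mem_nhds hx)).congr ?_
    filter_upwards [hW.mem_nhds hx] with y hy using (hf y hy).symm

variable [NormedSpace ℝ B] [ChartedSpace E N]

variable (E) in
/-- A chart of the orbit space in which the projection is a smooth submersion. -/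
structure IsQuotientChart (c : OpenPartialHomeomorph (MulAction.orbitRel.Quotient G N) B) :
    Prop where
  contMDiffAt : ∀ x, proj G N x ∈ c.source → ContMDiffAt 𝓘(ℝ, E) 𝓘(ℝ, B) ∞ (c ∘ proj G N) x
  exists_section : ∀ x, proj G N x ∈ c.source → ∃ σ : B → N, σ (c (proj G N x)) = x ∧
    ContMDiffAt 𝓘(ℝ, B) 𝓘(ℝ, E) ∞ σ (c (proj G N x)) ∧
    proj G N ∘ σ =ᶠ[𝓝 (c (proj G N x))] c.symm

/-- Near `b` the transition map is (c' ∘ π) ∘ σ for a local section σ of π, a composite of smooth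
maps. -/
theorem IsQuotientChart.contDiffAt_comp_symm
    {c c' : OpenPartialHomeomorph (MulAction.orbitRel.Quotient G N) B}
    (hc : IsQuotientChart E c) (hc' : IsQuotientChart E c') {b : B} (hb : b ∈ c.target)
    (hb' : c.symm b ∈ c'.source) : ContDiffAt ℝ ∞ (c' ∘ c.symm) b := by
  obtain ⟨x, hx⟩ := proj_surjective (c.symm b)
  have hxs : proj G N x ∈ c.source := by
    rw [hx]
    exact c.map_target hb
  obtain ⟨σ, hσx, hσ, hσc⟩ := hc.exists_section x hxs
  have hbx : c (proj G N x) = b := by rw [hx, c.right_inv hb]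
  rw [hbx] at hσx hσ hσc
  refine ContMDiffAt.contDiffAt ?_
  refine ContMDiffAt.congr_of_eventuallyEq (f := (c' ∘ proj G N) ∘ σ) ?_
    (hσc.symm.fun_comp c')
  refine ContMDiffAt.comp b ?_ hσ
  rw [hσx]
  exact hc'.contMDiffAt x (by rwa [hx])

end Quotient

/-! ### The quotient manifold structure -/

section QuotientManifold

variable {F : Type*} [NormedAddCommGroup F] [NormedSpace ℝ F] [FiniteDimensional ℝ F]
  {E : Type*} [NormedAddCommGroup E] [NormedSpace ℝ E] [FiniteDimensional ℝ E]
  {G : Type*} [Group G] [TopologicalSpace G] [ChartedSpace F G] [LieGroup 𝓘(ℝ, F) ∞ G] [T2Space G]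
  {N : Type*} [TopologicalSpace N] [ChartedSpace E N] [IsManifold 𝓘(ℝ, E) ∞ N]
  [MulAction G N] [ContMDiffSMul 𝓘(ℝ, F) 𝓘(ℝ, E) ∞ G N]

variable (F) in
-- A slice controls π only on `W`. Translations by group elements, which leave π unchanged, carry
-- this to every point of the orbits meeting `W`.
theorem exists_isQuotientChart [ProperSMul G N] (hfree : ∀ (g : G) (x : N), g • x = x → g = 1)
    {q : ℕ} (hq : q + Module.finrank ℝ F = Module.finrank ℝ E)
    (p : MulAction.orbitRel.Quotient G N) :
    ∃ c : OpenPartialHomeomorph (MulAction.orbitRel.Quotient G N) (EuclideanSpace ℝ (Fin q)),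
      p ∈ c.source ∧ IsQuotientChart E c := by
  obtain ⟨x₀, rfl⟩ := proj_surjective p
  obtain ⟨S, W, slice, coord, hS, hW, hx₀, hslice, hcoord, hsc, hcs, hinj⟩ :=
    exists_slice F hfree hq x₀
  obtain ⟨c, hsrc, htgt, hc, hcsymm⟩ := exists_chart_of_slice hS hW
    (fun s hs => (hslice s hs).continuousAt.continuousWithinAt)
    (fun x hx => (hcoord x hx).continuousAt.continuousWithinAt) hsc hcs hinj
  have htr : ∀ g : G, ContMDiff 𝓘(ℝ, E) 𝓘(ℝ, E) ∞ (fun x : N => g • x) := fun g =>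
    ContMDiffSMul.contMDiff_const_smul (I := 𝓘(ℝ, F)) (I' := 𝓘(ℝ, E)) (n := ∞) g
  refine ⟨c, hsrc ▸ mem_image_of_mem _ hx₀, fun x hx => ?_, fun x hx => ?_⟩
  · rw [hsrc] at hx
    obtain ⟨y, hy, hyx⟩ := hx
    obtain ⟨g, rfl⟩ := proj_eq_iff.1 hyx
    have h1 : (c ∘ proj G N) =ᶠ[𝓝 x] coord ∘ fun z => g • z := by
      filter_upwards [(htr g).continuous.continuousAt.preimage_mem_nhds (hW.mem_nhds hy)] with z hz
      change c (proj G N z) = coord (g • z)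
      rw [← hc _ hz, proj_smul]
    exact ((hcoord _ hy).comp x (htr g).contMDiffAt).congr_of_eventuallyEq h1
  · rw [hsrc] at hx
    obtain ⟨y, hy, hyx⟩ := hx
    obtain ⟨hyS, g, hg⟩ := hcs y hy
    have hcx : c (proj G N x) = coord y := by rw [← hyx, hc y hy]
    obtain ⟨k, hk⟩ := proj_eq_iff.1 hyx.symm
    -- Here x = k • y and y = g • slice (coord y), so this translate of the slice passes through
    -- `x`.
    refine ⟨fun s => (k * g) • slice s, ?_, ?_, ?_⟩
    · change (k * g) • slice (c (proj G N x)) = x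
      rw [hcx, mul_smul, ← hg, hk]
    · rw [hcx]
      exact (htr (k * g)).contMDiffAt.comp _ (hslice _ hyS)
    · refine Filter.Eventually.of_forall fun s => ?_
      rw [hcsymm]
      exact proj_smul _ _

/-- The orbit space of a free and proper smooth action is a quotient manifold. -/
theorem exists_isQuotientManifold [ProperSMul G N]
    (hfree : ∀ (g : G) (x : N), g • x = x → g = 1)
    {q : ℕ} (hq : q + Module.finrank ℝ F = Module.finrank ℝ E) :
    ∃ _ : ChartedSpace (EuclideanSpace ℝ (Fin q)) (MulAction.orbitRel.Quotient G N),
      IsQuotientManifold E (EuclideanSpace ℝ (Fin q)) G N := by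
  choose chart hmem hchart using exists_isQuotientChart F (E := E) (G := G) (N := N) hfree hq
  let cs : ChartedSpace (EuclideanSpace ℝ (Fin q)) (MulAction.orbitRel.Quotient G N) :=
    { atlas := range chart
      chartAt := chart
      mem_chart_source := hmem
      chart_mem_atlas := mem_range_self }
  have hman : IsManifold 𝓘(ℝ, EuclideanSpace ℝ (Fin q)) ∞ (MulAction.orbitRel.Quotient G N) := by
    refine isManifold_of_contDiffOn _ _ _ ?_
    rintro _ _ ⟨p, rfl⟩ ⟨p', rfl⟩ b hb
    exact ((hchart p).contDiffAt_comp_symm (hchart p') hb.1.1 hb.1.2).contDiffWithinAt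
  have hproj : ContMDiff 𝓘(ℝ, E) 𝓘(ℝ, EuclideanSpace ℝ (Fin q)) ∞ (proj G N) := fun x => by
    refine contMDiffAt_iff_target.2 ⟨continuous_quotient_mk'.continuousAt, ?_⟩
    exact (hchart (proj G N x)).contMDiffAt x (hmem _)
  refine ⟨cs, hman, hproj, fun x => ?_⟩
  -- Differentiating π ∘ σ = (inverse chart) shows that dπ has an invertible map as a composite with
  -- dσ, so dπ is surjective.
  obtain ⟨σ, hσx, hσ, hσc⟩ := (hchart (proj G N x)).exists_section x (hmem _)
  have hpx := mem_extChartAt_source (I := 𝓘(ℝ, EuclideanSpace ℝ (Fin q))) (proj G N x)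
  have h1 := tderiv_comp (E := EuclideanSpace ℝ (Fin q)) (E' := E)
    (E'' := EuclideanSpace ℝ (Fin q)) (g := proj G N) (f := σ)
    (chart (proj G N x) (proj G N x)) (hproj.mdifferentiable (by simp) _)
    (hσ.mdifferentiableAt (by simp))
  rw [tderiv_congr hσc, hσx] at h1
  have h2 := tderiv_extChartAt_comp_symm hpx
  have h3 := tderiv_extChartAt_symm_comp hpx
  intro (v : EuclideanSpace ℝ (Fin q))
  refine ⟨tderiv (EuclideanSpace ℝ (Fin q)) E σ (chart (proj G N x) (proj G N x))
    (tderiv _ (EuclideanSpace ℝ (Fin q)) (extChartAt 𝓘(ℝ, EuclideanSpace ℝ (Fin q)) (proj G N x))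
      (proj G N x) v), ?_⟩
  refine Eq.trans ?_ (congrArg (· v) h3)
  exact (congrArg (· (tderiv _ (EuclideanSpace ℝ (Fin q))
    (extChartAt 𝓘(ℝ, EuclideanSpace ℝ (Fin q)) (proj G N x)) (proj G N x) v)) h1).symm

end QuotientManifold

/-! ### Surjective submersions and their local sections -/

section Submersion

variable {E : Type*} [NormedAddCommGroup E] [NormedSpace ℝ E]
  {M : Type*} [TopologicalSpace M] [ChartedSpace E M]
  {E' : Type*} [NormedAddCommGroup E'] [NormedSpace ℝ E']
  {M' : Type*} [TopologicalSpace M'] [ChartedSpace E' M']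

theorem pullback_injective {k : ℕ} {h : M → M'} (hsurj : Function.Surjective h)
    (hsub : ∀ x, Function.Surjective (tderiv E E' h x)) :
    Function.Injective (pullback h : FormField E' M' k → FormField E M k) := by
  intro β₁ β₂ hβ
  funext p
  obtain ⟨x, rfl⟩ := hsurj p
  ext v
  choose w hw using fun i => hsub x (v i)
  obtain rfl : (fun i => tderiv E E' h x (w i)) = v := funext hw
  exact congrArg (fun β : FormField E M k => β x w) hβ

variable [IsManifold 𝓘(ℝ, E) ∞ M]

/-- In a chart of the base, β = σ^* h^* β = σ^* α for a local section σ. This is how regularity and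
closedness pass from the total space to the base. -/
theorem eventually_pull_section_eq_localForm {k : ℕ} {h : M → M'}
    (hh : ContMDiff 𝓘(ℝ, E) 𝓘(ℝ, E') ∞ h) {α : FormField E M k} {β : FormField E' M' k}
    (hβ : pullback h β = α) {p : M'} {σ : E' → M} {y : E'}
    (hσ : ContMDiffAt 𝓘(ℝ, E') 𝓘(ℝ, E) ∞ σ y)
    (hs : h ∘ σ =ᶠ[𝓝 y] (extChartAt 𝓘(ℝ, E') p).symm) :
    localForm β p =ᶠ[𝓝 y] (pull σ α : E' → E' [⋀^Fin k]→L[ℝ] ℝ) := by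
  filter_upwards [eventually_mdifferentiableAt hσ, pull_congr (E := E') β hs] with z hz hz'
  rw [localForm_eq_pull, ← hz', ← hβ]
  exact (pull_pull β z (hh.mdifferentiable (by simp) _) hz).symm

variable [FiniteDimensional ℝ E'] [IsManifold 𝓘(ℝ, E') ∞ M']

theorem exists_continuous_rightInverse {P : E →L[ℝ] E'} (hP : Function.Surjective P) :
    ∃ R : E' →L[ℝ] E, ∀ v, P (R v) = v := by
  obtain ⟨R, hR⟩ := (P : E →ₗ[ℝ] E').exists_rightInverse_of_surjective
    (LinearMap.range_eq_top.2 hP)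
  exact ⟨LinearMap.toContinuousLinearMap R, fun v => congrArg (· v) hR⟩

/-- Local sections of a submersion, expressed in a chart of the base. -/
theorem exists_local_section {h : M → M'} (hh : ContMDiff 𝓘(ℝ, E) 𝓘(ℝ, E') ∞ h) {x : M}
    (hx : Function.Surjective (tderiv E E' h x)) {p : M'}
    (hp : h x ∈ (extChartAt 𝓘(ℝ, E') p).source) :
    ∃ σ : E' → M, σ (extChartAt 𝓘(ℝ, E') p (h x)) = x ∧
      ContMDiffAt 𝓘(ℝ, E') 𝓘(ℝ, E) ∞ σ (extChartAt 𝓘(ℝ, E') p (h x)) ∧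
      h ∘ σ =ᶠ[𝓝 (extChartAt 𝓘(ℝ, E') p (h x))] (extChartAt 𝓘(ℝ, E') p).symm := by
  set φ := extChartAt 𝓘(ℝ, E') p with hφ
  set χ := extChartAt 𝓘(ℝ, E) x with hχ
  have hxs : x ∈ χ.source := mem_extChartAt_source x
  have hxt : χ x ∈ χ.target := χ.map_source hxs
  have hχx : χ.symm (χ x) = x := χ.left_inv hxs
  have hχs := contMDiffAt_extChartAt_symm_of_mem hxt
  have hhχ : ContMDiffAt 𝓘(ℝ, E) 𝓘(ℝ, E') ∞ (h ∘ χ.symm) (χ x) := hh.contMDiffAt.comp _ hχs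
  let f : E → E' := fun z => φ (h (χ.symm z))
  have hf : ContDiffAt ℝ ∞ f (χ x) :=
    extChartAt_comp_contDiffAt p hhχ (by
      change h (χ.symm (χ x)) ∈ φ.source
      rwa [hχx])
  have hsurj : Function.Surjective (fderiv ℝ f (χ x)) := by
    have hφd : MDifferentiableAt 𝓘(ℝ, E') 𝓘(ℝ, E') φ (h x) :=
      mdifferentiableAt_extChartAt (by rwa [hφ, extChartAt_source] at hp)
    have h1 := tderiv_comp (E := E) (E' := E) (E'' := E') (g := h) (χ x)
      (hh.mdifferentiable (by simp) _) (hχs.mdifferentiableAt (by simp))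
    have h2 := tderiv_comp (E := E) (E' := E') (E'' := E') (g := φ) (f := h ∘ χ.symm) (χ x)
      (by
        change MDifferentiableAt _ _ φ (h (χ.symm (χ x)))
        rwa [hχx])
      (hhχ.mdifferentiableAt (by simp))
    rw [h1, Function.comp_apply, hχx, tderiv_eq_fderiv] at h2
    intro v
    obtain ⟨w, hw⟩ := hx (tderiv E' E' φ.symm (φ (h x)) v)
    refine ⟨tderiv E E χ x w, (congrArg (· (tderiv E E χ x w)) h2).trans ?_⟩
    have h3 := congrArg (· w) (tderiv_extChartAt_symm_comp hxs)
    have h4 := congrArg (· v) (tderiv_extChartAt_comp_symm hp)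
    simp only [ContinuousLinearMap.comp_apply, ContinuousLinearMap.id_apply] at h3 h4
    rw [ContinuousLinearMap.comp_apply, ContinuousLinearMap.comp_apply, h3, hw, h4]
  -- Restricted to the affine subspace through `χ x` in the directions of a right inverse `R`, the
  -- map `f` has derivative the identity. Its local inverse then gives the section.
  obtain ⟨R, hR⟩ := exists_continuous_rightInverse hsurj
  let f₂ : E' → E' := fun s => f (χ x + R s)
  have h0 : χ x + R 0 = χ x := by rw [map_zero, add_zero]
  have hf₂ : ContDiffAt ℝ ∞ f₂ 0 :=
    ContDiffAt.comp (g := f) 0 (by rwa [h0]) (contDiff_const.add R.contDiff).contDiffAt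
  have hf₂' : HasFDerivAt f₂ ((ContinuousLinearEquiv.refl ℝ E' : E' ≃L[ℝ] E') : E' →L[ℝ] E') 0 := by
    have h1 : HasFDerivAt f (fderiv ℝ f (χ x)) (χ x + R 0) := by
      rw [h0]
      exact (hf.differentiableAt (by simp)).hasFDerivAt
    have h2 := HasFDerivAt.comp (g := f) 0 h1 (R.hasFDerivAt.const_add (χ x))
    have h3 : (fderiv ℝ f (χ x)).comp R =
        ((ContinuousLinearEquiv.refl ℝ E' : E' ≃L[ℝ] E') : E' →L[ℝ] E') := by
      ext1 v
      exact hR v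
    rwa [h3] at h2
  let e := hf₂.toOpenPartialHomeomorph f₂ hf₂' (by simp)
  have hf₂0 : f₂ 0 = φ (h x) := by
    change φ (h (χ.symm (χ x + R 0))) = _
    rw [h0, hχx]
  have he : ContDiffAt ℝ ∞ e.symm (φ (h x)) := by
    rw [← hf₂0]
    exact hf₂.to_localInverse hf₂' (by simp)
  have het : φ (h x) ∈ e.target := by
    rw [← hf₂0]
    exact hf₂.image_mem_toOpenPartialHomeomorph_target hf₂' (by simp)
  have he0 : e.symm (φ (h x)) = 0 := by
    rw [← hf₂0]
    exact hf₂.localInverse_apply_image hf₂' (by simp)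
  let σ : E' → M := fun y => χ.symm (χ x + R (e.symm y))
  have hσx : σ (φ (h x)) = x := by
    change χ.symm (χ x + R (e.symm (φ (h x)))) = x
    rw [he0, h0, hχx]
  have hσ : ContMDiffAt 𝓘(ℝ, E') 𝓘(ℝ, E) ∞ σ (φ (h x)) := by
    refine ContMDiffAt.comp (g := χ.symm) (φ (h x)) ?_
      (contDiffAt_const.add (R.contDiff.contDiffAt.comp _ he)).contMDiffAt
    rwa [he0, h0]
  refine ⟨σ, hσx, hσ, ?_⟩
  have h1 : ∀ᶠ y in 𝓝 (φ (h x)), h (σ y) ∈ φ.source := by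
    refine (hh.continuous.continuousAt.comp hσ.continuousAt).eventually
      ((isOpen_extChartAt_source p).mem_nhds ?_)
    change h (σ (φ (h x))) ∈ φ.source
    rwa [hσx]
  filter_upwards [h1, e.open_target.mem_nhds het] with y hy hye
  have h2 : φ (h (σ y)) = y := e.right_inv hye
  change h (σ y) = φ.symm y
  rw [← φ.left_inv hy, h2]

/-- A form whose pullback under a surjective submersion is smooth is smooth. -/
theorem IsSmooth.of_pullback {k : ℕ} {h : M → M'} (hh : ContMDiff 𝓘(ℝ, E) 𝓘(ℝ, E') ∞ h)
    (hsurj : Function.Surjective h) (hsub : ∀ x, Function.Surjective (tderiv E E' h x))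
    {β : FormField E' M' k} (hβ : IsSmooth (pullback h β : FormField E M k)) : IsSmooth β := by
  intro p y hy
  obtain ⟨x, hx⟩ := hsurj ((extChartAt 𝓘(ℝ, E') p).symm y)
  have hxs : h x ∈ (extChartAt 𝓘(ℝ, E') p).source := by
    rw [hx]
    exact (extChartAt 𝓘(ℝ, E') p).map_target hy
  obtain ⟨σ, -, hσ, hs⟩ := exists_local_section hh (hsub x) hxs
  rw [hx, (extChartAt 𝓘(ℝ, E') p).right_inv hy] at hσ hs
  exact ((hβ.contDiffAt_pull hσ).congr_of_eventuallyEq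
    (eventually_pull_section_eq_localForm hh rfl hσ hs)).contDiffWithinAt

/-- A form whose pullback under a surjective submersion is closed is closed. -/
theorem extD_eq_zero_of_pullback {k : ℕ} {h : M → M'} (hh : ContMDiff 𝓘(ℝ, E) 𝓘(ℝ, E') ∞ h)
    (hsurj : Function.Surjective h) (hsub : ∀ x, Function.Surjective (tderiv E E' h x))
    {β : FormField E' M' k} (hβ : IsSmooth (pullback h β : FormField E M k))
    (hcl : extD (pullback h β : FormField E M k) = 0) : extD β = 0 := by
  funext p
  obtain ⟨x, rfl⟩ := hsurj p
  obtain ⟨σ, -, hσ, hs⟩ := exists_local_section hh (hsub x) (mem_extChartAt_source (h x))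
  rw [extD_eq, (eventually_pull_section_eq_localForm hh rfl hσ hs).extDeriv_eq,
    hβ.extDeriv_pull hσ, hcl]
  rfl

end Submersion

/-! ### Descent of invariant horizontal forms -/

section Descent

/-- Replace the arguments one at a time: each replacement changes the value by that of `β` on a
tuple with an entry in `K`. -/
theorem map_eq_of_sub_mem {V : Type*} [NormedAddCommGroup V] [NormedSpace ℝ V] {k : ℕ}
    (β : V [⋀^Fin k]→L[ℝ] ℝ) {K : Submodule ℝ V} (hK : ∀ v i, v i ∈ K → β v = 0)
    {v w : Fin k → V} (hvw : ∀ i, v i - w i ∈ K) : β v = β w := by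
  classical
  have h : ∀ s : Finset (Fin k), β (s.piecewise v w) = β w := by
    intro s
    induction s using Finset.induction_on with
    | empty => simp
    | insert j s hj ih =>
      rw [Finset.piecewise_insert, ← ih, ← sub_eq_zero]
      have h1 : s.piecewise v w = Function.update (s.piecewise v w) j (w j) := by
        rw [Function.eq_update_iff]
        simp [hj]
      conv_lhs => rw [h1, Function.update_idem]
      rw [← ContinuousAlternatingMap.map_update_sub]
      exact hK _ j (by simpa using hvw j)
  simpa using h Finset.univ

variable {F : Type*} [NormedAddCommGroup F] [NormedSpace ℝ F] [FiniteDimensional ℝ F]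
  {E : Type*} [NormedAddCommGroup E] [NormedSpace ℝ E] [FiniteDimensional ℝ E]
  {B : Type*} [NormedAddCommGroup B] [NormedSpace ℝ B]
  {G : Type*} [Group G] [TopologicalSpace G] [ChartedSpace F G] [LieGroup 𝓘(ℝ, F) ∞ G] [T2Space G]
  {N : Type*} [TopologicalSpace N] [ChartedSpace E N] [IsManifold 𝓘(ℝ, E) ∞ N]
  [MulAction G N] [ContMDiffSMul 𝓘(ℝ, F) 𝓘(ℝ, E) ∞ G N]
  [ChartedSpace B (MulAction.orbitRel.Quotient G N)]

/-- π is constant on orbits, so vertical vectors lie in the kernel. Equality is a dimension count,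
using injectivity of `orbitDeriv`. -/
theorem ker_tderiv_proj (hfree : ∀ (g : G) (x : N), g • x = x → g = 1)
    (hdim : Module.finrank ℝ B + Module.finrank ℝ F = Module.finrank ℝ E)
    (hquot : IsQuotientManifold E B G N) (x : N) :
    LinearMap.ker (tderiv E B (proj G N) x : E →ₗ[ℝ] B) =
      LinearMap.range (orbitDeriv E F G x : F →ₗ[ℝ] E) := by
  symm
  refine Submodule.eq_of_le_of_finrank_eq ?_ ?_
  · rintro _ ⟨ξ, rfl⟩
    have h1 : proj G N ∘ (fun g : G => g • x) = fun _ => proj G N x :=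
      funext fun g => proj_smul g x
    have h2 := tderiv_comp (E := F) (E' := E) (E'' := B) (g := proj G N)
      (f := fun g : G => g • x) 1 (hquot.contMDiff_proj.mdifferentiable (by simp) _)
      ((contMDiff_orbit (F := F) (E := E) (G := G) x).mdifferentiable (by simp) _)
    rw [h1, tderiv_const, one_smul] at h2
    exact (congrArg (· ξ) h2).symm
  · have h1 := LinearMap.finrank_range_add_finrank_ker (tderiv E B (proj G N) x : E →ₗ[ℝ] B)
    have h2 : LinearMap.range (tderiv E B (proj G N) x : E →ₗ[ℝ] B) = ⊤ :=
      LinearMap.range_eq_top.2 (hquot.surjective_mfderiv_proj x)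
    rw [h2, finrank_top] at h1
    rw [LinearMap.finrank_range_of_inj (orbitDeriv_injective hfree x)]
    omega

/-- A closed horizontal form descends to the orbit space. -/
theorem exists_pullback_proj_eq [FiniteDimensional ℝ B] [PreconnectedSpace G]
    (hfree : ∀ (g : G) (x : N), g • x = x → g = 1)
    (hdim : Module.finrank ℝ B + Module.finrank ℝ F = Module.finrank ℝ E)
    (hquot : IsQuotientManifold E B G N) {m : ℕ}
    {α : FormField E N (m + 1)} (hα : IsSmooth α) (hcl : extD α = 0)
    (hhor : ∀ (x : N) (ξ : F) (v : Fin (m + 1) → E) (i), v i = orbitDeriv E F G x ξ → α x v = 0) :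
    ∃ β : FormField B (MulAction.orbitRel.Quotient G N) (m + 1), pullback (proj G N) β = α := by
  have hsub : ∀ x, Function.Surjective (tderiv E B (proj G N) x) := hquot.surjective_mfderiv_proj
  choose R hR using fun x => exists_continuous_rightInverse (hsub x)
  have hproj := hquot.contMDiff_proj.mdifferentiable (n := ∞) (by simp)
  -- Evaluate α at a chosen point of the orbit on chosen lifts of the vectors. Invariance removes
  -- the dependence on the point, horizontality that on the lifts.
  refine ⟨fun p => (α p.out : E [⋀^Fin (m + 1)]→L[ℝ] ℝ).compContinuousLinearMap (R p.out), ?_⟩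
  funext x
  obtain ⟨g, hg⟩ := proj_eq_iff.1 (Quotient.out_eq (proj G N x)).symm
  set x₀ : N := (proj G N x).out with hx₀
  refine ContinuousAlternatingMap.ext fun (v : Fin (m + 1) → E) => ?_
  change α x₀ (fun i => R x₀ (tderiv E B (proj G N) x (v i))) = α x v
  rw [← pull_translate_eq hα hcl (fun x ξ v h => hhor x ξ v 0 h) g x₀]
  change α (g • x₀) (fun i => tderiv E E (fun y : N => g • y) x₀
    (R x₀ (tderiv E B (proj G N) x (v i)))) = α x v
  rw [hg]
  refine map_eq_of_sub_mem (V := E) (α x) (K := LinearMap.ker (tderiv E B (proj G N) x :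
    E →ₗ[ℝ] B)) (fun w i hw => ?_) (fun i => ?_)
  · rw [ker_tderiv_proj hfree hdim hquot x] at hw
    obtain ⟨ξ, hξ⟩ := hw
    exact hhor x ξ w i hξ.symm
  -- The translated lift and `v i` have the same image under dπ, because π ∘ g = π. They therefore
  -- differ by a vertical vector.
  · have h1 : proj G N ∘ (fun y : N => g • y) = proj G N := funext fun y => proj_smul g y
    have h2 := tderiv_comp (E := E) (E' := E) (E'' := B) (g := proj G N)
      (f := fun y : N => g • y) x₀ (hproj _)
      ((ContMDiffSMul.contMDiff_const_smul (I := 𝓘(ℝ, F)) (I' := 𝓘(ℝ, E)) (n := ∞)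
        g).mdifferentiable (by simp) _)
    rw [h1, hg] at h2
    rw [LinearMap.mem_ker, map_sub, sub_eq_zero]
    refine (congrArg (· (R x₀ (tderiv E B (proj G N) x (v i)))) h2).symm.trans ?_
    exact hR x₀ _

end Descent

/-! ### Top exterior powers and contraction -/

section ExteriorPower

theorem ιMulti_ne_zero {K V : Type*} [Field K] [AddCommGroup V] [Module K V] {n : ℕ}
    {v : Fin n → V} (hv : LinearIndependent K v) : exteriorPower.ιMulti K n v ≠ 0 := by
  -- The wedges indexed by n-element subsets of `Fin n` are independent. The identity embedding
  -- picks out the full subset.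
  have h := (exteriorPower.ιMulti_family_linearIndependent_field (n := n) hv).ne_zero
    (Set.powersetCard.ofFinEmbEquiv (RelEmbedding.refl (· ≤ ·)))
  rw [exteriorPower.ιMulti_family, Equiv.symm_apply_apply] at h
  exact h

theorem exists_smul_ιMulti_eq {K V : Type*} [Field K] [AddCommGroup V] [Module K V] {n : ℕ}
    (b : Module.Basis (Fin n) K V) (w : ⋀[K]^n V) :
    ∃ c : K, c • exteriorPower.ιMulti K n b = w := by
  have : Module.Finite K V := b.finiteDimensional_of_finite
  refine exists_smul_eq_of_finrank_eq_one ?_ (ιMulti_ne_zero b.linearIndependent) w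
  rw [exteriorPower.finrank_eq, Module.finrank_eq_card_basis b, Fintype.card_fin, Nat.choose_self]

variable {V : Type*} [AddCommGroup V] [Module ℝ V] [TopologicalSpace V] {l s k : ℕ}

theorem contract_smul (h : l + s = k) (α : V [⋀^Fin k]→L[ℝ] ℝ) (c : ℝ) (Z : ⋀[ℝ]^l V)
    (v : Fin s → V) : contract h α (c • Z) v = c * contract h α Z v := by
  simp [contract]

/-- The concatenated arguments (u, v) are linearly dependent. -/
theorem contract_ιMulti_eq_zero_of_mem_span (h : l + s = k) (α : V [⋀^Fin k]→L[ℝ] ℝ)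
    {u : Fin l → V} {v : Fin s → V} {i : Fin s} (hi : v i ∈ Submodule.span ℝ (range u)) :
    contract h α (exteriorPower.ιMulti ℝ l u) v = 0 := by
  subst h
  rw [contract_ιMulti]
  refine α.toAlternatingMap.map_linearDependent _ fun hli => ?_
  have h1 := hli.notMem_span_image (s := range (Fin.castAdd s)) (x := Fin.natAdd l i) (by
    rintro ⟨j, hj⟩
    have := congrArg Fin.val hj
    simp only [Fin.val_castAdd, Fin.val_natAdd] at this
    omega)
  refine h1 ?_
  rw [← range_comp]
  have h2 : (Fin.append u v ∘ Fin.cast rfl) ∘ Fin.castAdd s = u := by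
    funext j
    simp
  rw [h2]
  simpa using hi

/-- No sign appears: the last factor of the wedge already stands just before the free arguments. -/
theorem contract_ιMulti_snoc (h : l + (s + 1) = k) (h' : l + 1 + s = k)
    (α : V [⋀^Fin k]→L[ℝ] ℝ) (u : Fin l → V) (y : V) (v : Fin s → V) :
    contract h' α (exteriorPower.ιMulti ℝ (l + 1) (Fin.snoc u y : Fin (l + 1) → V)) v =
      contract h α (exteriorPower.ιMulti ℝ l u) (Fin.cons y v : Fin (s + 1) → V) := by
  rw [contract_ιMulti, contract_ιMulti, Fin.append_left_snoc]
  rfl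

theorem contract_one (h : 1 + s = s + 1) (β : V [⋀^Fin (s + 1)]→L[ℝ] ℝ) (Z : ⋀[ℝ]^1 V)
    (v : Fin s → V) :
    contract h β Z v = β (Fin.cons (exteriorPower.oneEquiv ℝ V Z) v : Fin (s + 1) → V) := by
  obtain ⟨u, rfl⟩ := (exteriorPower.oneEquiv ℝ V).symm.surjective Z
  rw [LinearEquiv.apply_symm_apply, exteriorPower.oneEquiv_symm_apply, contract_ιMulti,
    Fin.append_left_eq_cons]
  rfl

end ExteriorPower

/-! ### Contraction with the fundamental multivector -/

section Main

variable {n r m k : ℕ}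
  {N : Type*} [TopologicalSpace N] [ChartedSpace (EuclideanSpace ℝ (Fin n)) N]
  {G : Type*} [Group G] [TopologicalSpace G] [ChartedSpace (EuclideanSpace ℝ (Fin r)) G]
  [MulAction G N]

variable (n r G) in
/-- The values at `x` of the fundamental vector fields of the standard basis of the Lie algebra. -/
def fundamentalFrame (x : N) : Fin r → TangentSpace (𝓡 n) x := fun i =>
  orbitDeriv (EuclideanSpace ℝ (Fin n)) (EuclideanSpace ℝ (Fin r)) G x
    (EuclideanSpace.basisFun (Fin r) ℝ i)

theorem mem_span_fundamentalFrame {x : N} {ξ : EuclideanSpace ℝ (Fin r)} {y : TangentSpace (𝓡 n) x}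
    (hy : y = orbitDeriv (EuclideanSpace ℝ (Fin n)) (EuclideanSpace ℝ (Fin r)) G x ξ) :
    y ∈ Submodule.span ℝ (range (fundamentalFrame n r G x)) := by
  have h : orbitDeriv (EuclideanSpace ℝ (Fin n)) (EuclideanSpace ℝ (Fin r)) G x ξ ∈
      Submodule.span ℝ (range fun i => orbitDeriv (EuclideanSpace ℝ (Fin n))
        (EuclideanSpace ℝ (Fin r)) G x (EuclideanSpace.basisFun (Fin r) ℝ i)) := by
    rw [← (EuclideanSpace.basisFun (Fin r) ℝ).sum_repr ξ, map_sum]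
    refine Submodule.sum_mem _ fun i _ => ?_
    rw [map_smul]
    exact Submodule.smul_mem _ _ (Submodule.subset_span (mem_range_self i))
  rw [hy]
  exact h

variable [IsManifold (𝓡 n) ∞ N] [T2Space G] [LieGroup (𝓡 r) ∞ G]
  [ContMDiffSMul (𝓡 r) (𝓡 n) ∞ G N]

/-- An `r`-vector on the fundamental vector fields of a free action of an `r`-dimensional group is
a multiple of the exterior product of a basis. -/
theorem exists_toMultivectorField_eq [Nonempty N] (hfree : ∀ (g : G) (x : N), g • x = x → g = 1)
    {w : ⋀[ℝ]^r (fundamentalFields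
      (EuclideanSpace ℝ (Fin r)) (EuclideanSpace ℝ (Fin n)) G N)} (hw : w ≠ 0) :
    ∃ c : ℝ, c ≠ 0 ∧ ∀ x : N, toMultivectorField w x =
      c • exteriorPower.ιMulti ℝ r (fundamentalFrame n r G x) := by
  have hinj : Function.Injective (fundamentalField
      (EuclideanSpace ℝ (Fin r)) (EuclideanSpace ℝ (Fin n)) G N) := fun ξ η h =>
    orbitDeriv_injective (F := EuclideanSpace ℝ (Fin r)) (E := EuclideanSpace ℝ (Fin n)) hfree
      (Classical.arbitrary N) (congrFun h (Classical.arbitrary N))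
  let b₁ : Module.Basis (Fin r) ℝ (EuclideanSpace ℝ (Fin r)) :=
    (EuclideanSpace.basisFun (Fin r) ℝ).toBasis
  -- The Lie algebra is the tangent space at 1, which as a type is the model space, so the standard
  -- basis can be reused.
  let b₀ : Module.Basis (Fin r) ℝ (GroupLieAlgebra (𝓡 r) G) := b₁
  let b : Module.Basis (Fin r) ℝ (fundamentalFields
      (EuclideanSpace ℝ (Fin r)) (EuclideanSpace ℝ (Fin n)) G N) :=
    b₀.map (LinearEquiv.ofInjective _ hinj)
  obtain ⟨c, rfl⟩ := exists_smul_ιMulti_eq b w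
  refine ⟨c, fun h => hw (by rw [h, zero_smul]), fun x => ?_⟩
  rw [toMultivectorField, map_smul, exteriorPower.map_apply_ιMulti]
  have h : ((LinearMap.proj x : (∀ y : N, TangentSpace (𝓡 n) y) →ₗ[ℝ] TangentSpace (𝓡 n) x) ∘ₗ
      (fundamentalFields (EuclideanSpace ℝ (Fin r)) (EuclideanSpace ℝ (Fin n)) G N).subtype) ∘ b =
      fundamentalFrame n r G x := by
    funext i
    change fundamentalField (EuclideanSpace ℝ (Fin r)) (EuclideanSpace ℝ (Fin n)) G N (b₀ i) x = _
    have h1 : b₀ i = (EuclideanSpace.basisFun (Fin r) ℝ).toBasis i := rfl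
    rw [h1, OrthonormalBasis.coe_toBasis]
    rfl
  exact congrArg (c • exteriorPower.ιMulti ℝ r ·) h

variable {q : ℕ} [ChartedSpace (EuclideanSpace ℝ (Fin q)) (MulAction.orbitRel.Quotient G N)]

/-- The form on the orbit space induced by `ι_w Θ` is nondegenerate. -/
theorem isNondegenerate_of_pullback_eq [Nonempty N]
    (hfree : ∀ (g : G) (x : N), g • x = x → g = 1) (hdim : q + r = n)
    (hquot : IsQuotientManifold (EuclideanSpace ℝ (Fin n)) (EuclideanSpace ℝ (Fin q)) G N)
    {Θ : FormField (EuclideanSpace ℝ (Fin n)) N k} (hΘ : IsNondegenerate (r + 1) Θ)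
    (hk : r + (m + 1) = k)
    {w : ⋀[ℝ]^r (fundamentalFields
      (EuclideanSpace ℝ (Fin r)) (EuclideanSpace ℝ (Fin n)) G N)} (hw : w ≠ 0)
    {β : FormField (EuclideanSpace ℝ (Fin q)) (MulAction.orbitRel.Quotient G N) (m + 1)}
    (hβ : pullback (proj G N) β = contractField hk Θ (toMultivectorField w)) :
    IsNondegenerate 1 β := by
  obtain ⟨c, hc, hwc⟩ := exists_toMultivectorField_eq hfree hw
  intro p Z hZ
  obtain ⟨x, rfl⟩ := proj_surjective p
  obtain ⟨y, hy⟩ := hquot.surjective_mfderiv_proj x (exteriorPower.oneEquiv ℝ _ Z)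
  let e := fundamentalFrame n r G x
  have hli : LinearIndependent ℝ e :=
    (EuclideanSpace.basisFun (Fin r) ℝ).toBasis.linearIndependent.map'
      (orbitDeriv (EuclideanSpace ℝ (Fin n)) (EuclideanSpace ℝ (Fin r)) G x :
        EuclideanSpace ℝ (Fin r) →ₗ[ℝ] EuclideanSpace ℝ (Fin n))
      (LinearMap.ker_eq_bot.2 (orbitDeriv_injective hfree x))
  -- Contracting Θ with c e₁ ∧ … ∧ e_r ∧ y equals ι_y ι_w Θ, the pullback of ι_Z β, which vanishes.
  -- Now (r+1)-nondegeneracy applies.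
  have h0 : c • exteriorPower.ιMulti ℝ (r + 1)
      (Fin.snoc e y : Fin (r + 1) → TangentSpace (𝓡 n) x) = 0 := by
    refine hΘ x _ fun s h => ?_
    obtain rfl : s = m := by omega
    ext v
    have h1 : contract hk (Θ x) (toMultivectorField w x)
        (Fin.cons y v : Fin (s + 1) → TangentSpace (𝓡 n) x) = 0 := by
      have h2 := congrArg (fun α : FormField (EuclideanSpace ℝ (Fin n)) N (s + 1) =>
        α x (Fin.cons y v : Fin (s + 1) → TangentSpace (𝓡 n) x)) hβ
      refine h2.symm.trans ?_
      have h3 := contract_one (Nat.add_comm 1 s) (β (proj G N x)) Z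
        (fun i => mfderiv (𝓡 n) (𝓡 q) (proj G N) x (v i))
      rw [hZ s (Nat.add_comm 1 s), ← hy] at h3
      refine Eq.trans ?_ h3.symm
      change β (proj G N x) (fun i => mfderiv (𝓡 n) (𝓡 q) (proj G N) x
        ((Fin.cons y v : Fin (s + 1) → TangentSpace (𝓡 n) x) i)) = _
      congr 1
      funext i
      refine Fin.cases ?_ (fun j => ?_) i <;> rfl
    rw [contract_smul, contract_ιMulti_snoc hk, ← contract_smul, ← hwc]
    exact h1
  have h1 := (smul_eq_zero.1 h0).resolve_left hc
  -- The frame `e` is independent, so a vanishing wedge with `y` puts `y` in its span, the vertical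
  -- space, on which dπ is zero.
  have h2 : y ∈ Submodule.span ℝ (range e) := by
    by_contra hy'
    exact ιMulti_ne_zero (linearIndependent_finSnoc.2 ⟨hli, hy'⟩) h1
  have h3 : Submodule.span ℝ (range e) ≤ LinearMap.ker (tderiv (EuclideanSpace ℝ (Fin n))
      (EuclideanSpace ℝ (Fin q)) (proj G N) x :
        EuclideanSpace ℝ (Fin n) →ₗ[ℝ] EuclideanSpace ℝ (Fin q)) := by
    rw [ker_tderiv_proj (F := EuclideanSpace ℝ (Fin r)) hfree (by simpa using hdim) hquot x]
    refine Submodule.span_le.2 ?_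
    rintro _ ⟨i, rfl⟩
    exact ⟨_, rfl⟩
  have h4 : exteriorPower.oneEquiv ℝ _ Z = 0 := hy.symm.trans (h3 h2)
  exact (exteriorPower.oneEquiv ℝ _).map_eq_zero_iff.1 h4

theorem contractField_eq_zero_of_vertical [Nonempty N]
    (hfree : ∀ (g : G) (x : N), g • x = x → g = 1)
    (Θ : FormField (EuclideanSpace ℝ (Fin n)) N k) (hk : r + (m + 1) = k)
    {w : ⋀[ℝ]^r (fundamentalFields
      (EuclideanSpace ℝ (Fin r)) (EuclideanSpace ℝ (Fin n)) G N)} (hw : w ≠ 0)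
    (x : N) (ξ : EuclideanSpace ℝ (Fin r)) (v : Fin (m + 1) → EuclideanSpace ℝ (Fin n))
    (i : Fin (m + 1)) (hi : v i = orbitDeriv (EuclideanSpace ℝ (Fin n))
      (EuclideanSpace ℝ (Fin r)) G x ξ) :
    contractField hk Θ (toMultivectorField w) x v = 0 := by
  obtain ⟨c, -, hwc⟩ := exists_toMultivectorField_eq hfree hw
  have h1 := contract_ιMulti_eq_zero_of_mem_span (V := TangentSpace (𝓡 n) x) hk (Θ x)
    (u := fundamentalFrame n r G x) (v := v) (i := i)
    (mem_span_fundamentalFrame hi)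
  rw [contractField, hwc]
  exact (contract_smul hk (Θ x) c _ v).trans (by rw [h1, mul_zero])

end Main

end Multisymplectic

end

/-! ### The reduction theorem -/

theorem mainTheorem1 {n r m k : ℕ}
    {N : Type*} [TopologicalSpace N] [T2Space N] [SecondCountableTopology N] [ConnectedSpace N]
    [ChartedSpace (EuclideanSpace ℝ (Fin n)) N] [IsManifold (𝓡 n) ∞ N]
    {G : Type*} [Group G] [TopologicalSpace G] [T2Space G] [SecondCountableTopology G]
    [ConnectedSpace G] [ChartedSpace (EuclideanSpace ℝ (Fin r)) G] [LieGroup (𝓡 r) ∞ G]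
    (hG : Multisymplectic.IsUnimodular r G)
    [MulAction G N] [ContMDiffSMul (𝓡 r) (𝓡 n) ∞ G N] [ProperSMul G N]
    (hfree : ∀ (g : G) (x : N), g • x = x → g = 1)
    (Θ : Multisymplectic.FormField (EuclideanSpace ℝ (Fin n)) N k)
    (hΘ : Multisymplectic.IsMultisymplectic Θ)
    (hΘ' : Multisymplectic.IsNondegenerate (r + 1) Θ)
    (hk : r + (m + 1) = k)
    (w : ⋀[ℝ]^r (Multisymplectic.fundamentalFields
      (EuclideanSpace ℝ (Fin r)) (EuclideanSpace ℝ (Fin n)) G N))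
    (hw : w ≠ 0)
    (hwΘ : Multisymplectic.IsHamiltonian hk Θ (Multisymplectic.toMultivectorField w)) :
    T2Space (MulAction.orbitRel.Quotient G N) ∧
    SecondCountableTopology (MulAction.orbitRel.Quotient G N) ∧
    ∃ q : ℕ, q + r = n ∧
      (∃ _ : ChartedSpace (EuclideanSpace ℝ (Fin q)) (MulAction.orbitRel.Quotient G N),
        Multisymplectic.IsQuotientManifold
          (EuclideanSpace ℝ (Fin n)) (EuclideanSpace ℝ (Fin q)) G N) ∧
      ∀ [ChartedSpace (EuclideanSpace ℝ (Fin q)) (MulAction.orbitRel.Quotient G N)],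
        Multisymplectic.IsQuotientManifold
          (EuclideanSpace ℝ (Fin n)) (EuclideanSpace ℝ (Fin q)) G N →
        ∃! Θ' : Multisymplectic.FormField (EuclideanSpace ℝ (Fin q))
            (MulAction.orbitRel.Quotient G N) (m + 1),
          Multisymplectic.IsMultisymplectic Θ' ∧
          Multisymplectic.pullback (Multisymplectic.proj G N) Θ' =
            Multisymplectic.contractField hk Θ (Multisymplectic.toMultivectorField w) := by
  have : ContinuousConstSMul G N := inferInstance
  have : SecondCountableTopology (MulAction.orbitRel.Quotient G N) :=
    ContinuousConstSMul.secondCountableTopology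
  have hrn : r ≤ n := by
    have h := LinearMap.finrank_le_finrank_of_injective
      (Multisymplectic.orbitDeriv_injective (E := EuclideanSpace ℝ (Fin n))
        (F := EuclideanSpace ℝ (Fin r)) hfree (Classical.arbitrary N))
    simpa using h
  have hdim : n - r + r = n := Nat.sub_add_cancel hrn
  refine ⟨inferInstance, this, n - r, hdim,
    Multisymplectic.exists_isQuotientManifold (F := EuclideanSpace ℝ (Fin r)) hfree
      (by simpa using hdim), fun {_} hquot => ?_⟩
  -- The Hamiltonian condition enters only through exactness: dθ is smooth, and closed since d² = 0.
  obtain ⟨θ, hθ, hθΘ⟩ := hwΘ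
  have := hquot.isManifold
  have hsub : ∀ x : N, Function.Surjective (Multisymplectic.tderiv (EuclideanSpace ℝ (Fin n))
      (EuclideanSpace ℝ (Fin (n - r))) (Multisymplectic.proj G N) x) :=
    hquot.surjective_mfderiv_proj
  have hsm : Multisymplectic.IsSmooth
      (Multisymplectic.contractField hk Θ (Multisymplectic.toMultivectorField w)) :=
    hθΘ ▸ hθ.extD
  have hcl : Multisymplectic.extD
      (Multisymplectic.contractField hk Θ (Multisymplectic.toMultivectorField w)) = 0 :=
    hθΘ ▸ hθ.extD_extD
  obtain ⟨β, hβ⟩ := Multisymplectic.exists_pullback_proj_eq (F := EuclideanSpace ℝ (Fin r))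
    (B := EuclideanSpace ℝ (Fin (n - r))) hfree (by simpa using hdim) hquot hsm hcl
    (Multisymplectic.contractField_eq_zero_of_vertical hfree Θ hk hw)
  refine ⟨β, ⟨⟨?_, ?_, ?_⟩, hβ⟩, fun β' hβ' => ?_⟩
  · exact .of_pullback hquot.contMDiff_proj Multisymplectic.proj_surjective hsub (by rwa [hβ])
  · exact Multisymplectic.extD_eq_zero_of_pullback hquot.contMDiff_proj
      Multisymplectic.proj_surjective hsub (by rwa [hβ]) (by rwa [hβ])
  · exact Multisymplectic.isNondegenerate_of_pullback_eq hfree hdim hquot hΘ' hk hw hβ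
  · exact Multisymplectic.pullback_injective Multisymplectic.proj_surjective hsub
      (hβ'.2.trans hβ.symm)
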